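/- A rational 1PFA is a one-way probabilistic finite automaton with rational transition probabilities which reads $\cent w\$$ from left to right, one symbol per step, and halts when it enters an accepting or a rejecting state. A language $L$ over a finite alphabet $\Sigma$ belongs to $\mathrm{S}^{=}_{rat}$ if some rational 1PFA accepts $w$ with probability exactly $\frac12$ if and only if $w\in L$, for every $w\in\Sigma^*$. A one-way quantum finite automaton with restart (1QFA$^{\circlearrowleft}$) has a finite state set $Q$ with pairwise disjoint sets $Q_{acc},Q_{rej},Q_{restart}$, an initial state $q_0$ outside these sets, and a unitary operator $U_\sigma$ on $\mathbb{C}^Q$ for each tape symbol $\sigma\in\Sigma\cup\{\cent,\$\}$. A round on input $w$ starts in $|q_0\rangle$ and reads $\cent w\$$ from left to right; after each application of $U_\sigma$ one measures whether the state is in $Q_{acc}$ (accept and halt), in $Q_{rej}$ (reject and halt), in $Q_{restart}$ (begin a new round from $|q_0\rangle$ at the left end-marker), or in none of them (continue with the projected state). Every round ends with probability $1$ when $\$$ has been read. A two-way finite automaton with quantum and classical states (2QCFA) has a finite quantum register, finitely many classical states, and a classical two-way head on $\cent w\$$; in each step the classical state and the scanned symbol determine a unitary transformation or an orthogonal measurement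 of the register, and these together with the outcome determine the next classical state and the head move; it halts on entering an accepting or rejecting classical state. An automaton recognizes $L$ with error bounded by $\epsilon$ if it accepts each $w\in L$, and rejects each $w\notin L$, with probability at least $1-\epsilon$. **Theorem.** (1) For every language $L\in\mathrm{S}^{=}_{rat}$ there is a number $n$ such that for every $\epsilon>0$ there are $n$-state 1QFA$^{\circlearrowleft}$'s $\mathcal M$ and $\mathcal M'$ such that - $\mathcal M$ recognizes $L$ with negative one-sided error $\epsilon$: each $w\in L$ is accepted with probability $1$, and each $w\notin L$ is rejected with probability at least $1-\epsilon$; - $\mathcal M'$ recognizes $\overline L=\Sigma^*\setminus L$ with positive one-sided error $\epsilon$: each $w\in\overline L$ is accepted with probability at least $1-\epsilon$, and each $w\notin\overline L$ is rejected with probability $1$. (2) The following languages belong to $\mathrm{S}^{=}_{rat}$: $L_{eq}=\{a^nb^n\mid n\ge 0\}$; $L_{pal}=\{w\in\Sigma^*\mid w=w^R\}$ for every finite alphabet $\Sigma$; $L_{square}=\{a^nb^{n^2}\mid n>0\}$; $L_{power}=\{a^nb^{2^n}\mid n\ge 0\}$; and every polynomial language $$\{a_1^{n_1}\cdots a_k^{n_k}b_1^{p_1(n_1,\dots,n_k)}\cdots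 b_r^{p_r(n_1,\dots,n_k)}\mid n_1,\dots,n_k\ge 0,\ p_i(n_1,\dots,n_k)\ge 0 \text{ for all } i\},$$ where $a_1,\dots,a_k,b_1,\dots,b_r$ are distinct symbols and $p_1,\dots,p_r$ are polynomials with integer coefficients. (3) For every $\epsilon>0$, each of $L_{square}$ and $L_{power}$ is recognized by a 2QCFA with error bounded by $\epsilon$. -/

import Mathlib

noncomputable section

namespace FiniteAutomata

/-- Tape symbols: the input letters together with the left and right end-markers. -/
inductive TapeSymbol (α : Type*) where
  | leftEnd : TapeSymbol α
  | letter : α → TapeSymbol α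
  | rightEnd : TapeSymbol α

/-- The tape holding the input `w` between the two end-markers. -/
def tape {α : Type*} (w : List α) : List (TapeSymbol α) :=
  TapeSymbol.leftEnd :: (w.map TapeSymbol.letter ++ [TapeSymbol.rightEnd])

/-! ### Rational one-way probabilistic automata and the class `S^=_rat` -/

/-- A one-way probabilistic finite automaton with rational transition probabilities:
`trans σ q q'` is the probability to go from `q` to `q'` when `σ` is scanned; the head moves one
square to the right in every step, and the computation halts as soon as an accepting or a
rejecting state is entered. -/
structure RationalPFA (Q α : Type*) [Fintype Q] [DecidableEq Q] where
  trans : TapeSymbol α → Matrix Q Q ℚ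
  trans_nonneg : ∀ σ q q', 0 ≤ trans σ q q'
  trans_sum : ∀ σ q, ∑ q', trans σ q q' = 1
  init : Q
  acc : Finset Q
  rej : Finset Q
  disjoint_acc_rej : Disjoint acc rej
  init_nonhalting : init ∉ acc ∪ rej

namespace RationalPFA

variable {Q α : Type*} [Fintype Q] [DecidableEq Q]

/-- The probability of accepting when the machine is in the nonhalting state `q` and the part of
the tape that is still to be read is the given list. -/
def acceptFrom (P : RationalPFA Q α) : List (TapeSymbol α) → Q → ℚ
  | [], _ => 0
  | σ :: u, q => ∑ q', P.trans σ q q' *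
      (if q' ∈ P.acc then 1 else if q' ∈ P.rej then 0 else P.acceptFrom u q')

/-- The probability that the input `w` is accepted. -/
def acceptProb (P : RationalPFA Q α) (w : List α) : ℚ :=
  P.acceptFrom (tape w) P.init

end RationalPFA

/-- The class `S^=_rat`: some rational one-way probabilistic finite automaton accepts exactly the
members of `L` with probability `1/2`. -/
def InSEqRat {α : Type*} (L : Language α) : Prop :=
  ∃ (n : ℕ) (P : RationalPFA (Fin n) α), ∀ w : List α, w ∈ L ↔ P.acceptProb w = 1 / 2

/-! ### One-way quantum finite automata with restart -/

/-- One nonfinal step: apply the unitary `U` to the superposition `ψ` and project onto the span of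
the states outside `H`. -/
def continueStep {Q : Type*} [Fintype Q] [DecidableEq Q] (U : Matrix.unitaryGroup Q ℂ)
    (H : Finset Q) (ψ : Q → ℂ) : Q → ℂ :=
  fun q => if q ∈ H then 0 else ((U : Matrix Q Q ℂ).mulVec ψ) q

/-- A one-way (Kondacs-Watrous) quantum finite automaton with restart. The entry
`U σ q' q` is the amplitude of the transition from `q` to `q'` when `σ` is scanned. -/
structure OneQFARestart (Q α : Type*) [Fintype Q] [DecidableEq Q] where
  U : TapeSymbol α → Matrix.unitaryGroup Q ℂ
  init : Q
  acc : Finset Q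
  rej : Finset Q
  restart : Finset Q
  disjoint_acc_rej : Disjoint acc rej
  disjoint_acc_restart : Disjoint acc restart
  disjoint_rej_restart : Disjoint rej restart
  init_non : init ∉ acc ∪ rej ∪ restart
  /-- Every round ends with probability one (by acceptance, rejection or restart) when the right
  end-marker has been read. -/
  round_ends : ∀ w : List α,
    (tape w).foldl (fun ψ σ => continueStep (U σ) (acc ∪ rej ∪ restart) ψ) (Pi.single init 1) = 0

namespace OneQFARestart

variable {Q α : Type*} [Fintype Q] [DecidableEq Q]

/-- The probability that a state of `A` is measured during the scan of the given list of tape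
symbols, started in the (unnormalized) superposition `ψ`. After each unitary step the measurement
"accept / reject / restart / continue" is made, and only the "continue" branch goes on. -/
def outcomeFrom (M : OneQFARestart Q α) (A : Finset Q) : List (TapeSymbol α) → (Q → ℂ) → ℝ
  | [], _ => 0
  | σ :: u, ψ => ∑ q ∈ A, ‖((M.U σ : Matrix Q Q ℂ).mulVec ψ) q‖ ^ 2 +
      M.outcomeFrom A u (continueStep (M.U σ) (M.acc ∪ M.rej ∪ M.restart) ψ)

/-- Acceptance probability of a single round. -/
def roundAcc (M : OneQFARestart Q α) (w : List α) : ℝ :=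
  M.outcomeFrom M.acc (tape w) (Pi.single M.init 1)

/-- Rejection probability of a single round. -/
def roundRej (M : OneQFARestart Q α) (w : List α) : ℝ :=
  M.outcomeFrom M.rej (tape w) (Pi.single M.init 1)

/-- Restart probability of a single round. -/
def roundRestart (M : OneQFARestart Q α) (w : List α) : ℝ :=
  M.outcomeFrom M.restart (tape w) (Pi.single M.init 1)

/-- Overall acceptance probability: the sum over `i` of the probability that the first `i` rounds
end in a restart and the next one accepts. (The three round probabilities are nonnegative with
sum `1`, so this series always converges.) -/
def acceptProb (M : OneQFARestart Q α) (w : List α) : ℝ :=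
  ∑' i : ℕ, M.roundRestart w ^ i * M.roundAcc w

/-- Overall rejection probability. -/
def rejectProb (M : OneQFARestart Q α) (w : List α) : ℝ :=
  ∑' i : ℕ, M.roundRestart w ^ i * M.roundRej w

/-- Positive one-sided error bounded by `ε`: members are accepted with probability at least
`1 - ε`, nonmembers are rejected with probability `1`. -/
def RecognizesPositive (M : OneQFARestart Q α) (L : Language α) (ε : ℝ) : Prop :=
  (∀ w ∈ L, 1 - ε ≤ M.acceptProb w) ∧ (∀ w ∉ L, M.rejectProb w = 1)

/-- Negative one-sided error bounded by `ε`: members are accepted with probability `1`,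
nonmembers are rejected with probability at least `1 - ε`. -/
def RecognizesNegative (M : OneQFARestart Q α) (L : Language α) (ε : ℝ) : Prop :=
  (∀ w ∈ L, M.acceptProb w = 1) ∧ (∀ w ∉ L, 1 - ε ≤ M.rejectProb w)

end OneQFARestart

/-! ### Two-way finite automata with quantum and classical states -/

/-- The operations on the quantum register: a unitary transformation, or an orthogonal measurement
given by finitely many mutually orthogonal projections that sum to the identity. -/
inductive QuantumOp (Q : Type*) [Fintype Q] [DecidableEq Q] where
  | unitary (U : Matrix.unitaryGroup Q ℂ) : QuantumOp Q
  | measurement (k : ℕ) (P : Fin k → Matrix Q Q ℂ) (isHermitian : ∀ i, (P i).IsHermitian)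
      (orthogonal : ∀ i j, P i * P j = if i = j then P i else 0) (sum_eq : ∑ i, P i = 1) :
      QuantumOp Q

namespace QuantumOp

variable {Q : Type*} [Fintype Q] [DecidableEq Q]

/-- The number of classical outcomes; a unitary transformation has the single outcome `0`. -/
def numOutcomes : QuantumOp Q → ℕ
  | unitary _ => 1
  | measurement k _ _ _ _ => k

/-- The linear map that the register undergoes when the given outcome occurs. -/
def branch : (o : QuantumOp Q) → Fin o.numOutcomes → Matrix Q Q ℂ
  | unitary U, _ => U
  | measurement _ P _ _ _, i => P i

end QuantumOp

/-- Head moves. -/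
inductive Direction where
  | left : Direction
  | stay : Direction
  | right : Direction

/-- The head position after a move. -/
def Direction.move : Direction → ℕ → ℕ
  | left, i => i - 1
  | stay, i => i
  | right, i => i + 1

/-- A two-way finite automaton with quantum states `Q` and classical states `S`. The head may not
leave the tape. -/
structure TwoQCFA (Q S α : Type*) [Fintype Q] [DecidableEq Q] [DecidableEq S] where
  Θ : S → TapeSymbol α → QuantumOp Q
  δ : (s : S) → (σ : TapeSymbol α) → Fin (Θ s σ).numOutcomes → S × Direction
  qInit : Q
  sInit : S
  acc : Finset S
  rej : Finset S
  disjoint_acc_rej : Disjoint acc rej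
  leftEnd_move : ∀ s j, (δ s TapeSymbol.leftEnd j).2 ≠ Direction.left
  rightEnd_move : ∀ s j, (δ s TapeSymbol.rightEnd j).2 ≠ Direction.right

namespace TwoQCFA

variable {Q S α : Type*} [Fintype Q] [DecidableEq Q] [DecidableEq S]

/-- The tape symbol at position `i` (only positions `i < w.length + 2` are ever visited). -/
def symbolAt (w : List α) (i : ℕ) : TapeSymbol α :=
  (tape w).getD i TapeSymbol.rightEnd

/-- The probability of halting in a classical state of `A` (the accepting or the rejecting set)
within `t` steps on input `w`, from classical state `s`, head position `i` and unnormalized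
quantum state `ψ`, whose squared norm is the probability of the branch. -/
def haltWithin (M : TwoQCFA Q S α) (w : List α) (A : Finset S) :
    ℕ → S → ℕ → (Q → ℂ) → ℝ
  | 0, s, _, ψ => if s ∈ A then ∑ q, ‖ψ q‖ ^ 2 else 0
  | t + 1, s, i, ψ =>
      if s ∈ M.acc ∪ M.rej then (if s ∈ A then ∑ q, ‖ψ q‖ ^ 2 else 0)
      else ∑ j : Fin (M.Θ s (symbolAt w i)).numOutcomes,
        M.haltWithin w A t (M.δ s (symbolAt w i) j).1 ((M.δ s (symbolAt w i) j).2.move i)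
          (((M.Θ s (symbolAt w i)).branch j).mulVec ψ)

/-- The probability that `w` is accepted: the limit of the probabilities of acceptance within `t`
steps, which increase with `t` and are at most `1`. -/
def acceptProb (M : TwoQCFA Q S α) (w : List α) : ℝ :=
  ⨆ t : ℕ, M.haltWithin w M.acc t M.sInit 0 (Pi.single M.qInit 1)

/-- The probability that `w` is rejected. -/
def rejectProb (M : TwoQCFA Q S α) (w : List α) : ℝ :=
  ⨆ t : ℕ, M.haltWithin w M.rej t M.sInit 0 (Pi.single M.qInit 1)

/-- Recognition with error bounded by `ε`. -/
def Recognizes (M : TwoQCFA Q S α) (L : Language α) (ε : ℝ) : Prop :=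
  (∀ w ∈ L, 1 - ε ≤ M.acceptProb w) ∧ (∀ w ∉ L, 1 - ε ≤ M.rejectProb w)

end TwoQCFA

/-! ### The languages; over the alphabet `Fin 2`, `0` is the letter `a` and `1` the letter `b` -/

/-- `{a^n b^n | n ≥ 0}`. -/
def langEq : Language (Fin 2) :=
  {w | ∃ n : ℕ, w = List.replicate n 0 ++ List.replicate n 1}

/-- The palindromes over `α`. -/
def langPal (α : Type*) : Language α :=
  {w | w = w.reverse}

/-- `{a^n b^(n^2) | n > 0}`. -/
def langSquare : Language (Fin 2) :=
  {w | ∃ n : ℕ, 0 < n ∧ w = List.replicate n 0 ++ List.replicate (n ^ 2) 1}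

/-- `{a^n b^(2^n) | n ≥ 0}`. -/
def langPower : Language (Fin 2) :=
  {w | ∃ n : ℕ, w = List.replicate n 0 ++ List.replicate (2 ^ n) 1}

/-- The polynomial language of `p`: the words `a_1^(n_1) ⋯ a_k^(n_k) b_1^(m_1) ⋯ b_r^(m_r)` with
`m_j = p_j(n_1, …, n_k) ≥ 0` for all `j`; here `a_i` is `Sum.inl i` and `b_j` is `Sum.inr j`. -/
def polynomialLanguage {k r : ℕ} (p : Fin r → MvPolynomial (Fin k) ℤ) :
    Language (Fin k ⊕ Fin r) :=
  {w | ∃ (n : Fin k → ℕ) (m : Fin r → ℕ),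
    (∀ j, (m j : ℤ) = MvPolynomial.eval (fun i => (n i : ℤ)) (p j)) ∧
    w = (List.ofFn fun i => List.replicate (n i) (Sum.inl i)).flatten ++
      (List.ofFn fun j => List.replicate (m j) (Sum.inr j)).flatten}

end FiniteAutomata

end

noncomputable section

namespace FiniteAutomata

/-! ### Rational series -/

/-! Everything passes through zero sets of rational series. Shifting the acceptance probability of a
rational 1PFA by `1 / 2` gives a rational series whose zero set is the language. Conversely, as in
Turakainen's theorem, doubling the states makes a linear representation nonnegative, and rescaling
makes it substochastic. The missing mass goes to a dead state that finally accepts with probability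
`1 / 2`, so the word `w` is accepted with probability `1 / 2 + κ * f w`, where `κ > 0`.

Rational series form an algebra under pointwise operations. Each language in (2) is therefore cut
out by equations between simple series (letter counts, powers, base-`B` values), and several
equations merge into one as a sum of squares.

For (1), clearing denominators gives an integer representation with the same zero set. A matrix
scaled by a small positive factor is a block of a unitary matrix (`exists_unitary_dilation`); the
amplitude that leaves the block goes to restart states. One round then accepts with probability `κ *
η ^ 2` and rejects with probability `κ * g ^ 2`, where `g` is the integer value of the series and `κ
> 0` depends on the word. Restarting cancels `κ`. If `g = 0`, acceptance is certain; otherwise `g ^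
2 ≥ 1`, and the choice `η ^ 2 = ε` bounds the error by `ε`. Only amplitudes depend on `ε`, not the
number of states. Exchanging the verdicts handles the complement.

For (3), a 2QCFA performs the rounds one after the other: it measures after every unitary step and,
upon a restart, swaps the register back to the initial state and rewinds the head. -/

/-- The rational series over `ℚ`: the functions on words that lie in some finitely generated space
of functions which is closed under the shifts `g ↦ g (a :: ·)`. -/
def rationalSeries (α : Type*) : Subalgebra ℚ (List α → ℚ) where
  carrier := {f | ∃ V : Submodule ℚ (List α → ℚ), V.FG ∧
    (∀ a, ∀ g ∈ V, (fun w => g (a :: w)) ∈ V) ∧ f ∈ V}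
  mul_mem' := by
    rintro f g ⟨V, hV, hVs, hf⟩ ⟨W, hW, hWs, hg⟩
    -- The shift is multiplicative for the pointwise product, so a product of shift-closed spaces is
    -- shift-closed.
    refine ⟨V * W, hV.mul hW, fun a x hx => ?_, Submodule.mul_mem_mul hf hg⟩
    induction hx using Submodule.mul_induction_on' with
    | mem_mul_mem m hm n hn => exact Submodule.mul_mem_mul (hVs a m hm) (hWs a n hn)
    | add x _ y _ hx hy => exact add_mem hx hy
  add_mem' := by
    rintro f g ⟨V, hV, hVs, hf⟩ ⟨W, hW, hWs, hg⟩
    refine ⟨V ⊔ W, hV.sup hW, fun a x hx => ?_, Submodule.add_mem_sup hf hg⟩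
    obtain ⟨y, hy, z, hz, rfl⟩ := Submodule.mem_sup.1 hx
    exact Submodule.add_mem_sup (hVs a y hy) (hWs a z hz)
  algebraMap_mem' r := by
    refine ⟨Submodule.span ℚ {1}, Submodule.fg_span_singleton _, fun a x hx => ?_,
      Submodule.mem_span_singleton.2 ⟨r, by ext; simp⟩⟩
    obtain ⟨y, rfl⟩ := Submodule.mem_span_singleton.1 hx
    exact Submodule.mem_span_singleton.2 ⟨y, rfl⟩

section

variable {α : Type*}

theorem const_mem_rationalSeries (r : ℚ) : (fun _ => r) ∈ rationalSeries α :=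
  (rationalSeries α).algebraMap_mem r

/-- The members of a finite family whose shifts are linear combinations of the family. -/
theorem mem_rationalSeries_of_family {ι : Type*} [Finite ι] (b : ι → List α → ℚ)
    (h : ∀ a i, (fun w => b i (a :: w)) ∈ Submodule.span ℚ (Set.range b)) (i : ι) :
    b i ∈ rationalSeries α := by
  refine ⟨Submodule.span ℚ (Set.range b), Submodule.fg_span (Set.finite_range b), fun a g hg => ?_,
    Submodule.subset_span ⟨i, rfl⟩⟩
  induction hg using Submodule.span_induction with
  | mem x hx => obtain ⟨i, rfl⟩ := hx; exact h a i
  | zero => exact zero_mem _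
  | add x y _ _ hx hy => exact add_mem hx hy
  | smul r x _ hx => exact Submodule.smul_mem _ r hx

/-- Adjoining `f` to the sum of shift-closed spaces containing the `g`'s leaves it shift-closed.
This gives membership from a one-letter recurrence, the form in which all concrete series below are
treated. -/
theorem mem_rationalSeries_of_shift [Finite α] (f : List α → ℚ)
    (h : ∀ a, ∃ k : ℚ, ∃ g ∈ rationalSeries α, ∀ w, f (a :: w) = k * f w + g w) :
    f ∈ rationalSeries α := by
  choose k g hg hf using h
  choose V hV hVs hgV using hg
  have hle : ⨆ a, V a ≤ Submodule.span ℚ {f} ⊔ ⨆ a, V a := le_sup_right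
  refine ⟨Submodule.span ℚ {f} ⊔ ⨆ a, V a,
    (Submodule.fg_span_singleton f).sup (Submodule.fg_iSup _ hV), fun a x hx => ?_,
    Submodule.mem_sup_left (Submodule.mem_span_singleton_self f)⟩
  obtain ⟨y, hy, z, hz, rfl⟩ := Submodule.mem_sup.1 hx
  obtain ⟨r, rfl⟩ := Submodule.mem_span_singleton.1 hy
  refine add_mem (?_ : (fun w => (r • f) (a :: w)) ∈ _) (?_ : (fun w => z (a :: w)) ∈ _)
  · have : (fun w => (r • f) (a :: w)) = (r * k a) • f + r • g a := by
      ext w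
      simp only [Pi.smul_apply, smul_eq_mul, Pi.add_apply, hf]
      ring
    rw [this]
    exact Submodule.add_mem_sup (Submodule.smul_mem _ _ (Submodule.mem_span_singleton_self f))
      (Submodule.smul_mem _ _ (Submodule.mem_iSup_of_mem a (hgV a)))
  · refine hle ?_
    clear hx
    induction hz using Submodule.iSup_induction' with
    | mem i x hx => exact Submodule.mem_iSup_of_mem i (hVs i a x hx)
    | zero => exact zero_mem _
    | add x y _ _ hx hy => exact add_mem hx hy

/-- A rational series has a matrix representation. -/
theorem exists_family_of_mem_rationalSeries {f : List α → ℚ} (hf : f ∈ rationalSeries α) :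
    ∃ (n : ℕ) (b : Fin n → List α → ℚ) (A : α → Matrix (Fin n) (Fin n) ℚ) (i₀ : Fin n),
      (∀ a i w, b i (a :: w) = ∑ j, A a i j * b j w) ∧ b i₀ = f := by
  obtain ⟨V, hV, hVs, hf⟩ := hf
  obtain ⟨n, s, rfl⟩ := Submodule.fg_iff_exists_fin_generating_family.1 hV
  -- Putting `f` in front of the generators makes it a member of the family, so the initial vector
  -- is a unit vector.
  let b : Fin (n + 1) → List α → ℚ := Fin.cons f s
  have hle : Submodule.span ℚ (Set.range s) ≤ Submodule.span ℚ (Set.range b) :=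
    Submodule.span_mono (by rintro _ ⟨i, rfl⟩; exact ⟨i.succ, rfl⟩)
  have hb : ∀ i, b i ∈ Submodule.span ℚ (Set.range s) := by
    intro i
    refine Fin.cases hf (fun i => ?_) i
    exact Submodule.subset_span ⟨i, rfl⟩
  have key : ∀ a i, ∃ c : Fin (n + 1) → ℚ, ∑ j, c j • b j = fun w => b i (a :: w) := fun a i =>
    (Submodule.mem_span_range_iff_exists_fun ℚ).1 (hle (hVs a _ (hb i)))
  choose A hA using key
  refine ⟨n + 1, b, A, 0, fun a i w => ?_, rfl⟩
  have := congrFun (hA a i) w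
  simpa using this.symm

/-- The language `L` is the zero set of a rational series. -/
def IsSeriesZeroSet (L : Language α) : Prop :=
  ∃ f ∈ rationalSeries α, ∀ w, w ∈ L ↔ f w = 0

/-- Over an ordered field a sum of squares vanishes only if both terms do. -/
theorem IsSeriesZeroSet.of_iff_and {L : Language α} {f g : List α → ℚ}
    (hf : f ∈ rationalSeries α) (hg : g ∈ rationalSeries α)
    (h : ∀ w, w ∈ L ↔ f w = 0 ∧ g w = 0) : IsSeriesZeroSet L := by
  refine ⟨f * f + g * g, add_mem (mul_mem hf hf) (mul_mem hg hg), fun w => ?_⟩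
  rw [h, Pi.add_apply, Pi.mul_apply, Pi.mul_apply, mul_self_add_mul_self_eq_zero]

end

/-! ### Zero sets of rational series and the class `S^=_rat` -/

namespace RationalPFA

/-- Renaming the states of an automaton. -/
def mapStates {Q Q' α : Type*} [Fintype Q] [DecidableEq Q] [Fintype Q'] [DecidableEq Q']
    (P : RationalPFA Q α) (e : Q ≃ Q') : RationalPFA Q' α where
  trans σ q q' := P.trans σ (e.symm q) (e.symm q')
  trans_nonneg σ q q' := P.trans_nonneg σ _ _
  trans_sum σ q := by
    rw [← P.trans_sum σ (e.symm q)]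
    exact e.symm.sum_comp (fun q' => P.trans σ (e.symm q) q')
  init := e P.init
  acc := P.acc.map e.toEmbedding
  rej := P.rej.map e.toEmbedding
  disjoint_acc_rej := (Finset.disjoint_map _).2 P.disjoint_acc_rej
  init_nonhalting := by
    rw [← Finset.map_union, Finset.mem_map_equiv, e.symm_apply_apply]
    exact P.init_nonhalting

theorem mapStates_acceptProb {Q Q' α : Type*} [Fintype Q] [DecidableEq Q] [Fintype Q']
    [DecidableEq Q'] (P : RationalPFA Q α) (e : Q ≃ Q') (w : List α) :
    (P.mapStates e).acceptProb w = P.acceptProb w := by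
  have key : ∀ (u : List (TapeSymbol α)) (q : Q),
      (P.mapStates e).acceptFrom u (e q) = P.acceptFrom u q := by
    intro u
    induction u with
    | nil => intro q; rfl
    | cons σ u ih =>
      intro q
      simp only [acceptFrom]
      rw [← e.sum_comp]
      refine Finset.sum_congr rfl fun q' _ => ?_
      simp [mapStates, ← ih]
  exact key _ _

variable {α : Type*}

/-- The acceptance probability from a given state, as a function of the unread letters, is a
rational series. -/
theorem acceptFrom_mem_rationalSeries {Q : Type*} [Fintype Q] [DecidableEq Q]
    (P : RationalPFA Q α) (q : Q) :
    (fun w : List α => P.acceptFrom (w.map TapeSymbol.letter ++ [TapeSymbol.rightEnd]) q) ∈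
      rationalSeries α := by
  -- The extra index `none` carries the constant series `1`, the contribution of a step into an
  -- accepting state.
  let b : Option Q → List α → ℚ := fun o w => o.elim 1 fun q =>
    P.acceptFrom (w.map TapeSymbol.letter ++ [TapeSymbol.rightEnd]) q
  refine mem_rationalSeries_of_family b (fun a i => ?_) (some q)
  cases i with
  | none => exact Submodule.subset_span ⟨none, rfl⟩
  | some q =>
    have : (fun w => b (some q) (a :: w)) = ∑ q', P.trans (TapeSymbol.letter a) q q' •
        (if q' ∈ P.acc then b none else if q' ∈ P.rej then 0 else b (some q')) := by
      ext w
      simp only [b, Option.elim_some, List.map_cons, List.cons_append, acceptFrom,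
        Finset.sum_apply, Pi.smul_apply, smul_eq_mul]
      refine Finset.sum_congr rfl fun q' _ => ?_
      split_ifs <;> rfl
    rw [this]
    refine sum_mem fun q' _ => Submodule.smul_mem _ _ ?_
    split_ifs
    · exact Submodule.subset_span ⟨none, rfl⟩
    · exact zero_mem _
    · exact Submodule.subset_span ⟨some q', rfl⟩

end RationalPFA

section

variable {α : Type*}

theorem InSEqRat.isSeriesZeroSet {L : Language α} (h : InSEqRat L) : IsSeriesZeroSet L := by
  obtain ⟨n, P, hP⟩ := h
  refine ⟨(fun w => P.acceptProb w) - fun _ => 1 / 2,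
    sub_mem ?_ (const_mem_rationalSeries _), fun w => ?_⟩
  · have : (fun w => P.acceptProb w) = ∑ q', P.trans TapeSymbol.leftEnd P.init q' •
        (if q' ∈ P.acc then (1 : List α → ℚ) else if q' ∈ P.rej then 0 else
          fun w => P.acceptFrom (w.map TapeSymbol.letter ++ [TapeSymbol.rightEnd]) q') := by
      ext w
      simp only [RationalPFA.acceptProb, tape, RationalPFA.acceptFrom, Finset.sum_apply,
        Pi.smul_apply, smul_eq_mul]
      refine Finset.sum_congr rfl fun q' _ => ?_
      split_ifs <;> rfl
    rw [this]
    refine sum_mem fun q' _ => Subalgebra.smul_mem _ ?_ _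
    split_ifs
    · exact one_mem _
    · exact zero_mem _
    · exact P.acceptFrom_mem_rationalSeries q'
  · rw [hP, Pi.sub_apply, sub_eq_zero]

/-! ### From rational series to probabilistic automata -/

/-- A rational series has a matrix representation with nonnegative matrices. -/
theorem exists_nonneg_family_of_mem_rationalSeries {f : List α → ℚ} (hf : f ∈ rationalSeries α) :
    ∃ (n : ℕ) (b : Fin n × Bool → List α → ℚ)
      (A : α → Matrix (Fin n × Bool) (Fin n × Bool) ℚ) (i₀ : Fin n × Bool),
      (∀ a i j, 0 ≤ A a i j) ∧ (∀ a i w, b i (a :: w) = ∑ j, A a i j * b j w) ∧ b i₀ = f := by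
  obtain ⟨n, b, A, i₀, hA, hf⟩ := exists_family_of_mem_rationalSeries hf
  -- Each series occurs with both signs: the positive part of a coefficient multiplies `b j`, the
  -- negative part multiplies `-b j`.
  refine ⟨n, fun p w => if p.2 then b p.1 w else -b p.1 w,
    fun a p q => if p.2 = q.2 then max (A a p.1 q.1) 0 else max (-A a p.1 q.1) 0, (i₀, true),
    fun a p q => ?_, fun a p w => ?_, ?_⟩
  · dsimp only
    split_ifs <;> exact le_max_right _ _
  · have h : ∀ x y : ℚ, max x 0 * y + max (-x) 0 * -y = x * y := by
      intro x y
      rcases le_total 0 x with hx | hx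
      · rw [max_eq_left hx, max_eq_right (by linarith)]; ring
      · rw [max_eq_right hx, max_eq_left (by linarith)]; ring
    obtain ⟨i, s⟩ := p
    rw [Fintype.sum_prod_type]
    cases s
    · simp only [Fintype.sum_bool, hA, Bool.false_eq_true, if_false, if_true]
      rw [← Finset.sum_neg_distrib]
      refine Finset.sum_congr rfl fun j _ => ?_
      rw [← h]
      ring
    · simp only [Fintype.sum_bool, hA, Bool.false_eq_true, if_false, if_true]
      refine Finset.sum_congr rfl fun j _ => ?_
      rw [← h]
      rfl
  · simpa using hf

/-- Transition matrices of the automaton with states `ι` and a dead, an accepting and a rejecting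
state which turns a nonnegative matrix representation into acceptance probabilities. -/
def seriesTrans {ι : Type*} [Fintype ι] [DecidableEq ι] (A : α → Matrix ι ι ℚ) (z : ι → ℚ) :
    TapeSymbol α → Matrix (ι ⊕ Fin 3) (ι ⊕ Fin 3) ℚ
  | .leftEnd => 1
  -- The normalizing factor is the same for all rows, so the vector of values is only multiplied by
  -- a scalar; each row's missing mass moves to the dead state.
  | .letter a => Matrix.fromBlocks ((1 + ∑ i, ∑ j, A a i j)⁻¹ • A a)
      (Matrix.of fun i => ![1 - (1 + ∑ i, ∑ j, A a i j)⁻¹ * ∑ j, A a i j, 0, 0]) 0 1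
  -- The factor makes the offset from `1 / 2` at most `1 / 2` in absolute value. The dead state
  -- accepts and rejects with equal probability.
  | .rightEnd => Matrix.fromBlocks 0
      (Matrix.of fun i => ![0, 1 / 2 + (2 * (1 + ∑ i, |z i|))⁻¹ * z i,
        1 / 2 - (2 * (1 + ∑ i, |z i|))⁻¹ * z i]) 0
      !![0, 1 / 2, 1 / 2; 0, 1, 0; 0, 0, 1]

theorem abs_inv_mul_le_half {ι : Type*} [Fintype ι] (z : ι → ℚ) (i : ι) :
    |(2 * (1 + ∑ i, |z i|))⁻¹ * z i| ≤ 1 / 2 := by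
  have h0 : 0 ≤ ∑ i, |z i| := Finset.sum_nonneg fun _ _ => abs_nonneg _
  have h1 : |z i| ≤ ∑ i, |z i| :=
    Finset.single_le_sum (f := fun i => |z i|) (fun _ _ => abs_nonneg _) (Finset.mem_univ i)
  rw [abs_mul, abs_of_pos (by positivity), inv_mul_le_iff₀ (by positivity)]
  linarith

theorem inv_mul_row_sum_le_one {ι : Type*} [Fintype ι] {A : Matrix ι ι ℚ}
    (hA : ∀ i j, 0 ≤ A i j) (i : ι) : (1 + ∑ i, ∑ j, A i j)⁻¹ * ∑ j, A i j ≤ 1 := by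
  have h0 : 0 ≤ ∑ i, ∑ j, A i j :=
    Finset.sum_nonneg fun _ _ => Finset.sum_nonneg fun _ _ => hA _ _
  have h1 : ∑ j, A i j ≤ ∑ i, ∑ j, A i j :=
    Finset.single_le_sum (f := fun i => ∑ j, A i j)
      (fun _ _ => Finset.sum_nonneg fun _ _ => hA _ _) (Finset.mem_univ i)
  rw [inv_mul_le_iff₀ (by positivity)]
  linarith

/-- The automaton with transition matrices `seriesTrans`. -/
def seriesPFA {ι : Type*} [Fintype ι] [DecidableEq ι] (A : α → Matrix ι ι ℚ) (z : ι → ℚ) (i₀ : ι)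
    (hA : ∀ a i j, 0 ≤ A a i j) : RationalPFA (ι ⊕ Fin 3) α where
  trans := seriesTrans A z
  trans_nonneg := by
    intro σ q q'
    have h0 : ∀ a, 0 ≤ ∑ i, ∑ j, A a i j := fun a =>
      Finset.sum_nonneg fun _ _ => Finset.sum_nonneg fun _ _ => hA a _ _
    cases σ with
    | leftEnd => simp only [seriesTrans, Matrix.one_apply]; split_ifs <;> norm_num
    | letter a =>
      rcases q with i | x <;> rcases q' with j | y
      · have := h0 a
        have := hA a i j
        simp only [seriesTrans, Matrix.fromBlocks_apply₁₁, Matrix.smul_apply, smul_eq_mul]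
        positivity
      · have := inv_mul_row_sum_le_one (hA a) i
        fin_cases y <;> simp [seriesTrans, this]
      · simp [seriesTrans]
      · simp only [seriesTrans, Matrix.fromBlocks_apply₂₂, Matrix.one_apply]
        split_ifs <;> norm_num
    | rightEnd =>
      rcases q with i | x <;> rcases q' with j | y
      · simp [seriesTrans]
      · have := abs_le.1 (abs_inv_mul_le_half z i)
        simp only [seriesTrans, Matrix.fromBlocks_apply₁₂, Matrix.of_apply]
        fin_cases y
        · simp
        · simp only [Fin.mk_one, Matrix.cons_val]; linarith
        · simp only [Fin.reduceFinMk, Matrix.cons_val]; linarith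
      · simp [seriesTrans]
      · fin_cases x <;> fin_cases y <;> simp [seriesTrans]
  trans_sum := by
    intro σ q
    cases σ with
    | leftEnd => simp [seriesTrans, Matrix.one_apply]
    | letter a =>
      rcases q with i | x
      · simp [seriesTrans, Fin.sum_univ_three, Finset.mul_sum]
      · simp [seriesTrans, Matrix.one_apply]
    | rightEnd =>
      rcases q with i | x
      · simp [seriesTrans, Fin.sum_univ_three]; ring
      · fin_cases x <;> simp [seriesTrans, Fin.sum_univ_three]; norm_num
  init := .inl i₀
  acc := {.inr 1}
  rej := {.inr 2}
  disjoint_acc_rej := by simp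
  init_nonhalting := by simp

/-- Induction on the unread word: as each row, dead state included, has sum `1`, the term `1 / 2` is
reproduced, while the deviation is transformed by the scaled matrix. The scale `κ` may depend on the
word but not on the state. -/
theorem seriesPFA_acceptFrom {ι : Type*} [Fintype ι] [DecidableEq ι] {A : α → Matrix ι ι ℚ}
    {b : ι → List α → ℚ} (i₀ : ι) (hA : ∀ a i j, 0 ≤ A a i j)
    (hb : ∀ a i w, b i (a :: w) = ∑ j, A a i j * b j w) (w : List α) :
    (seriesPFA A (fun i => b i []) i₀ hA).acceptFrom
        (w.map TapeSymbol.letter ++ [TapeSymbol.rightEnd]) (.inr 0) = 1 / 2 ∧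
    ∃ κ : ℚ, 0 < κ ∧ ∀ i, (seriesPFA A (fun i => b i []) i₀ hA).acceptFrom
        (w.map TapeSymbol.letter ++ [TapeSymbol.rightEnd]) (.inl i) = 1 / 2 + κ * b i w := by
  induction w with
  | nil =>
    have h0 : 0 ≤ ∑ i, |b i []| := Finset.sum_nonneg fun _ _ => abs_nonneg _
    constructor
    · simp [RationalPFA.acceptFrom, seriesPFA, seriesTrans]
    · refine ⟨(2 * (1 + ∑ i, |b i []|))⁻¹, by positivity, fun i => ?_⟩
      simp [RationalPFA.acceptFrom, seriesPFA, seriesTrans]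
  | cons a w ih =>
    obtain ⟨hd, κ, hκ, hi⟩ := ih
    have h0 : 0 ≤ ∑ i, ∑ j, A a i j :=
      Finset.sum_nonneg fun _ _ => Finset.sum_nonneg fun _ _ => hA a _ _
    have hacc : (seriesPFA A (fun i => b i []) i₀ hA).acc = {.inr 1} := rfl
    have hrej : (seriesPFA A (fun i => b i []) i₀ hA).rej = {.inr 2} := rfl
    have htr : (seriesPFA A (fun i => b i []) i₀ hA).trans =
      seriesTrans A (fun i => b i []) := rfl
    constructor
    · simp [RationalPFA.acceptFrom, hacc, hrej, htr, seriesTrans, Fin.sum_univ_three, hd,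
        Matrix.one_apply]
    · refine ⟨(1 + ∑ i, ∑ j, A a i j)⁻¹ * κ, by positivity, fun i => ?_⟩
      simp only [RationalPFA.acceptFrom, List.map_cons, List.cons_append, hacc, hrej, htr,
        seriesTrans, Fintype.sum_sum_type, Fin.sum_univ_three, hd, hi, hb]
      have hsum : ∑ j, (1 + ∑ i, ∑ j, A a i j)⁻¹ * A a i j * (1 / 2 + κ * b j w) =
          1 / 2 * ((1 + ∑ i, ∑ j, A a i j)⁻¹ * ∑ j, A a i j) +
            (1 + ∑ i, ∑ j, A a i j)⁻¹ * κ * ∑ j, A a i j * b j w := by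
        rw [Finset.mul_sum, Finset.mul_sum, Finset.mul_sum, ← Finset.sum_add_distrib]
        exact Finset.sum_congr rfl fun j _ => by ring
      simp only [Matrix.fromBlocks_apply₁₁, Matrix.fromBlocks_apply₁₂, Matrix.smul_apply,
        smul_eq_mul, Finset.mem_singleton, reduceCtorEq, if_false, Matrix.of_apply, hsum]
      simp
      ring

theorem IsSeriesZeroSet.inSEqRat {L : Language α} (h : IsSeriesZeroSet L) : InSEqRat L := by
  obtain ⟨f, hf, hL⟩ := h
  obtain ⟨n, b, A, i₀, hA, hb, rfl⟩ := exists_nonneg_family_of_mem_rationalSeries hf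
  refine ⟨_, (seriesPFA A (fun i => b i []) i₀ hA).mapStates (Fintype.equivFin _), fun w => ?_⟩
  obtain ⟨-, κ, hκ, hi⟩ := seriesPFA_acceptFrom i₀ hA hb w
  rw [hL, RationalPFA.mapStates_acceptProb]
  have : (seriesPFA A (fun i => b i []) i₀ hA).acceptProb w = 1 / 2 + κ * b i₀ w := by
    rw [← hi i₀, RationalPFA.acceptProb, tape, RationalPFA.acceptFrom]
    simp [seriesPFA, seriesTrans, Matrix.one_apply]
  rw [this]
  simp [hκ.ne']

end

/-! ### Languages that are zero sets of rational series -/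

section

variable {α : Type*}

/-! ### Counting and exponential series -/

theorem count_mem_rationalSeries [Finite α] [BEq α] [LawfulBEq α] (x : α) :
    (fun w : List α => (w.count x : ℚ)) ∈ rationalSeries α := by
  refine mem_rationalSeries_of_shift _ fun a =>
    ⟨1, _, const_mem_rationalSeries (if a == x then 1 else 0), fun w => ?_⟩
  cases h : a == x <;> simp [List.count_cons, h]

theorem two_pow_count_mem_rationalSeries [Finite α] [BEq α] [LawfulBEq α] (x : α) :
    (fun w : List α => (2 : ℚ) ^ w.count x) ∈ rationalSeries α := by
  refine mem_rationalSeries_of_shift _ fun a =>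
    ⟨if a == x then 2 else 1, _, const_mem_rationalSeries 0, fun w => ?_⟩
  cases h : a == x <;> simp [List.count_cons, h, pow_succ, mul_comm]

theorem count_eq_zero_mem_rationalSeries [Finite α] [BEq α] [LawfulBEq α] (x : α) :
    (fun w : List α => if w.count x = 0 then (1 : ℚ) else 0) ∈ rationalSeries α := by
  refine mem_rationalSeries_of_shift _ fun a =>
    ⟨if a == x then 0 else 1, _, const_mem_rationalSeries 0, fun w => ?_⟩
  cases h : a == x <;> simp [List.count_cons, h]

theorem pow_length_mem_rationalSeries [Finite α] (B : ℚ) :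
    (fun w : List α => B ^ w.length) ∈ rationalSeries α :=
  mem_rationalSeries_of_shift _ fun _ =>
    ⟨B, _, const_mem_rationalSeries 0, fun w => by simp [pow_succ, mul_comm]⟩

/-! ### Words with sorted letters -/

/-- The words whose letters appear with weakly increasing keys. -/
def KeySorted (key : α → ℕ) (w : List α) : Prop :=
  w.Pairwise fun x y => key x ≤ key y

theorem keySorted_cons_cons (key : α → ℕ) (x a : α) (w : List α) :
    KeySorted key (x :: a :: w) ↔ key x ≤ key a ∧ KeySorted key (a :: w) := by
  simp only [KeySorted, List.pairwise_cons, List.mem_cons, forall_eq_or_imp]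
  constructor
  · rintro ⟨⟨h1, -⟩, h2⟩
    exact ⟨h1, h2⟩
  · rintro ⟨h1, h2, h3⟩
    exact ⟨⟨h1, fun y hy => h1.trans (h2 y hy)⟩, h2, h3⟩

open Classical in
theorem not_keySorted_mem_rationalSeries [Finite α] (key : α → ℕ) :
    (fun w : List α => if KeySorted key w then (0 : ℚ) else 1) ∈ rationalSeries α := by
  have h : (fun w : List α => if KeySorted key w then (1 : ℚ) else 0) ∈ rationalSeries α := by
    -- Besides the indicator of sorted words, the family contains the indicators of `x :: w` being
    -- sorted. Reading `a` after `x` gives the member for `a`, or zero if the two letters are out of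
    -- order.
    let b : Option α → List α → ℚ := fun o w => if KeySorted key (o.elim w (· :: w)) then 1 else 0
    refine mem_rationalSeries_of_family b (fun a i => ?_) none
    cases i with
    | none => exact Submodule.subset_span ⟨some a, rfl⟩
    | some x =>
      by_cases hx : key x ≤ key a
      · refine Submodule.subset_span ⟨some a, ?_⟩
        ext w
        simp only [b, Option.elim_some, keySorted_cons_cons, hx, true_and]
        congr
      · convert zero_mem (Submodule.span ℚ (Set.range b)) using 1
        ext w
        simp [b, keySorted_cons_cons, hx]
  convert sub_mem (one_mem _) h using 1
  ext w
  by_cases hw : KeySorted key w <;> simp [hw]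

theorem KeySorted.eq_of_count_eq [BEq α] [LawfulBEq α] {key : α → ℕ} (hkey : Function.Injective key)
    {v w : List α} (hv : KeySorted key v) (hw : KeySorted key w)
    (h : ∀ x, v.count x = w.count x) : v = w :=
  (List.perm_iff_count.2 h).eq_of_pairwise
    (fun _ _ _ _ h1 h2 => hkey (le_antisymm h1 h2)) hv hw

theorem IsSeriesZeroSet.of_keySorted [Finite α] {L : Language α} (key : α → ℕ) {f : List α → ℚ}
    (hf : f ∈ rationalSeries α) (h : ∀ w, w ∈ L ↔ KeySorted key w ∧ f w = 0) :
    IsSeriesZeroSet L := by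
  classical
  refine IsSeriesZeroSet.of_iff_and (not_keySorted_mem_rationalSeries key) hf fun w => ?_
  rw [h]
  by_cases hw : KeySorted key w <;> simp [hw]

theorem eq_replicate_append_replicate_iff (w : List (Fin 2)) (n m : ℕ) :
    w = List.replicate n 0 ++ List.replicate m 1 ↔
      KeySorted Fin.val w ∧ w.count 0 = n ∧ w.count 1 = m := by
  have hs : KeySorted Fin.val
      (List.replicate n (0 : Fin 2) ++ List.replicate m (1 : Fin 2)) := by
    simp [KeySorted, List.pairwise_append, List.pairwise_replicate, List.mem_replicate]
  constructor
  · rintro rfl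
    exact ⟨hs, by simp [List.count_replicate], by simp [List.count_replicate]⟩
  · rintro ⟨hw, rfl, rfl⟩
    refine hw.eq_of_count_eq Fin.val_injective hs fun x => ?_
    fin_cases x <;> simp [List.count_replicate]

/-! ### The languages of the theorem -/

theorem isSeriesZeroSet_langEq : IsSeriesZeroSet langEq := by
  refine .of_keySorted Fin.val
    (sub_mem (count_mem_rationalSeries 0) (count_mem_rationalSeries 1)) fun w => ?_
  change (∃ n, _) ↔ _
  simp only [eq_replicate_append_replicate_iff, Pi.sub_apply, sub_eq_zero, Nat.cast_inj]
  constructor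
  · rintro ⟨n, h, h0, h1⟩
    exact ⟨h, h0.trans h1.symm⟩
  · rintro ⟨h, h0⟩
    exact ⟨_, h, rfl, h0.symm⟩

theorem isSeriesZeroSet_langPower : IsSeriesZeroSet langPower := by
  refine .of_keySorted Fin.val
    (sub_mem (two_pow_count_mem_rationalSeries 0) (count_mem_rationalSeries 1)) fun w => ?_
  change (∃ n, _) ↔ _
  simp only [eq_replicate_append_replicate_iff, Pi.sub_apply, sub_eq_zero]
  norm_cast
  constructor
  · rintro ⟨n, h, rfl, h1⟩
    exact ⟨h, h1.symm⟩
  · rintro ⟨h, h0⟩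
    exact ⟨_, h, rfl, h0.symm⟩

theorem isSeriesZeroSet_langSquare : IsSeriesZeroSet langSquare := by
  have hc := count_mem_rationalSeries (0 : Fin 2)
  obtain ⟨f, hf, hfw⟩ : IsSeriesZeroSet {w : List (Fin 2) | w.count 0 ≠ 0 ∧
      w.count 0 ^ 2 = w.count 1} := by
    -- The condition `n > 0` is the vanishing of the indicator of words without the letter `0`.
    refine .of_iff_and (count_eq_zero_mem_rationalSeries 0)
      (sub_mem (pow_mem hc 2) (count_mem_rationalSeries 1)) fun w => ?_
    simp only [Pi.sub_apply, Pi.pow_apply, sub_eq_zero, ite_eq_right_iff]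
    norm_cast
  refine .of_keySorted Fin.val hf fun w => ?_
  rw [← hfw]
  change (∃ n, _) ↔ _
  simp only [eq_replicate_append_replicate_iff]
  constructor
  · rintro ⟨n, hn, h, rfl, h1⟩
    exact ⟨h, hn.ne', h1.symm⟩
  · rintro ⟨h, h0, h1⟩
    exact ⟨_, Nat.pos_of_ne_zero h0, h, rfl, h1.symm⟩

/-- A word and its reversal are compared as numerals of equal length. The base `n + 2` exceeds every
digit and is at least `2` even for tiny alphabets. -/
theorem isSeriesZeroSet_langPal [Finite α] : IsSeriesZeroSet (langPal α) := by
  obtain ⟨n, ⟨e⟩⟩ := Finite.exists_equiv_fin α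
  let d : α → ℕ := fun a => e a
  have hd : Function.Injective d := Fin.val_injective.comp e.injective
  have h1 : (fun w : List α => ((Nat.ofDigits (n + 2) (w.map d) : ℕ) : ℚ)) ∈ rationalSeries α :=
    mem_rationalSeries_of_shift _ fun a =>
      ⟨(n + 2 : ℕ), _, const_mem_rationalSeries (d a : ℚ), fun w => by
        rw [List.map_cons, Nat.ofDigits_cons]; push_cast; ring⟩
  have h2 : (fun w : List α => ((Nat.ofDigits (n + 2) (w.reverse.map d) : ℕ) : ℚ)) ∈
      rationalSeries α :=
    mem_rationalSeries_of_shift _ fun a =>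
      -- In the reversed numeral the first letter becomes the most significant digit and adds `d a *
      -- (n + 2) ^ w.length`.
      ⟨1, _, Subalgebra.smul_mem _ (pow_length_mem_rationalSeries ((n + 2 : ℕ) : ℚ)) (d a : ℚ),
        fun w => by
        rw [List.reverse_cons, List.map_append, Nat.ofDigits_append]
        simp [Nat.ofDigits_singleton, mul_comm]⟩
  refine ⟨_, sub_mem h1 h2, fun w => ?_⟩
  rw [Pi.sub_apply, sub_eq_zero]
  norm_cast
  change w = w.reverse ↔ _
  constructor
  · intro h
    rw [← h]
  · intro h
    have hlt : ∀ v : List α, ∀ l ∈ v.map d, l < n + 2 := by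
      intro v l hl
      obtain ⟨a, -, rfl⟩ := List.mem_map.1 hl
      have := (e a).isLt
      simp only [d]
      omega
    exact hd.list_map (Nat.ofDigits_inj_of_len_eq (by omega) (by simp) (hlt w) (hlt _) h)

theorem eval_mem_rationalSeries {σ : Type*} (p : MvPolynomial σ ℤ) (c : σ → List α → ℤ)
    (hc : ∀ i, (fun w => (c i w : ℚ)) ∈ rationalSeries α) :
    (fun w => ((MvPolynomial.eval (fun i => c i w) p : ℤ) : ℚ)) ∈ rationalSeries α := by
  induction p using MvPolynomial.induction_on with
  | C a => simpa using const_mem_rationalSeries (α := α) (a : ℚ)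
  | add p q hp hq =>
    simp only [map_add, Int.cast_add]
    exact add_mem hp hq
  | mul_X p i hp =>
    simp only [map_mul, MvPolynomial.eval_X, Int.cast_mul]
    exact mul_mem hp (hc i)

theorem count_flatten_ofFn_replicate [BEq α] [LawfulBEq α] {k : ℕ} (n : Fin k → ℕ) (g : Fin k → α)
    (x : α) : (List.ofFn fun i => List.replicate (n i) (g i)).flatten.count x =
      ∑ i, if g i == x then n i else 0 := by
  simp [List.count_flatten, List.map_ofFn, List.sum_ofFn, Function.comp_def, List.count_replicate]

theorem keySorted_flatten_ofFn_replicate {k : ℕ} (n : Fin k → ℕ) (g : Fin k → α) (key : α → ℕ)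
    (hg : Monotone (key ∘ g)) :
    KeySorted key (List.ofFn fun i => List.replicate (n i) (g i)).flatten := by
  rw [KeySorted, List.pairwise_flatten]
  constructor
  · intro l hl
    obtain ⟨i, rfl⟩ := (List.mem_ofFn' _ _).1 hl
    simp [List.pairwise_replicate]
  · rw [List.pairwise_ofFn]
    intro i j hij x hx y hy
    rw [List.eq_of_mem_replicate hx, List.eq_of_mem_replicate hy]
    exact hg hij.le

theorem isSeriesZeroSet_polynomialLanguage {k r : ℕ} (p : Fin r → MvPolynomial (Fin k) ℤ) :
    IsSeriesZeroSet (polynomialLanguage p) := by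
  let key : Fin k ⊕ Fin r → ℕ := Sum.elim (fun i => i) (fun j => k + j)
  have hkey : Function.Injective key := by
    rintro (i | i) (j | j) h <;> simp [key] at h ⊢ <;> omega
  -- Counting in the sum type uses its own Boolean equality test, whose lawfulness is checked by
  -- cases.
  have : LawfulBEq (Fin k ⊕ Fin r) :=
    { eq_of_beq := by
        rintro (a | a) (b | b) h <;> simpa [BEq.beq, Sum.instBEq.beq] using h
      rfl := by
        rintro (a | a) <;> simp [BEq.beq, Sum.instBEq.beq] }
  let word : (Fin k → ℕ) → (Fin r → ℕ) → List (Fin k ⊕ Fin r) := fun n m =>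
    (List.ofFn fun i => List.replicate (n i) (Sum.inl i)).flatten ++
      (List.ofFn fun j => List.replicate (m j) (Sum.inr j)).flatten
  have hword : ∀ n m, KeySorted key (word n m) := by
    intro n m
    refine List.pairwise_append.2 ⟨keySorted_flatten_ofFn_replicate _ _ _ fun i j h => ?_,
      keySorted_flatten_ofFn_replicate _ _ _ fun i j h => ?_, fun x hx y hy => ?_⟩
    · simpa [key] using h
    · simpa [key] using h
    · simp only [List.mem_flatten, List.mem_ofFn, exists_exists_eq_and, List.mem_replicate] at hx hy
      obtain ⟨i, -, rfl⟩ := hx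
      obtain ⟨j, -, rfl⟩ := hy
      simp only [key, Sum.elim_inl, Sum.elim_inr]
      omega
  have hl : ∀ n m i, (word n m).count (Sum.inl i) = n i := fun n m i => by
    simp [word, count_flatten_ofFn_replicate]
  have hr : ∀ n m j, (word n m).count (Sum.inr j) = m j := fun n m j => by
    simp [word, count_flatten_ofFn_replicate]
  have hw : ∀ w n m, w = word n m ↔
      KeySorted key w ∧ (∀ i, w.count (.inl i) = n i) ∧ ∀ j, w.count (.inr j) = m j := by
    intro w n m
    constructor
    · rintro rfl
      exact ⟨hword n m, hl n m, hr n m⟩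
    · rintro ⟨hs, h1, h2⟩
      refine hs.eq_of_count_eq hkey (hword n m) ?_
      rintro (i | j)
      · rw [h1, hl]
      · rw [h2, hr]
  let f : Fin r → List (Fin k ⊕ Fin r) → ℚ := fun j w => w.count (.inr j) -
    ((MvPolynomial.eval (fun i => (w.count (.inl i) : ℤ)) (p j) : ℤ) : ℚ)
  have hf : ∀ j, f j ∈ rationalSeries _ := fun j =>
    sub_mem (count_mem_rationalSeries _) (eval_mem_rationalSeries (p j) _ fun i => by
      simpa using count_mem_rationalSeries (Sum.inl i))
  -- The `r` polynomial equations merge into one sum of squares. Counts are nonnegative, so `p j ≥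
  -- 0` needs no separate test.
  refine .of_keySorted key (f := ∑ j, f j * f j)
    (sum_mem fun j _ => mul_mem (hf j) (hf j)) fun w => ?_
  have hzero : (∑ j, f j * f j) w = 0 ↔ ∀ j, (w.count (.inr j) : ℤ) =
      MvPolynomial.eval (fun i => (w.count (.inl i) : ℤ)) (p j) := by
    simp only [Finset.sum_apply, Pi.mul_apply]
    rw [Finset.sum_eq_zero_iff_of_nonneg fun j _ => mul_self_nonneg (f j w)]
    simp only [Finset.mem_univ, true_imp_iff, mul_self_eq_zero, f, sub_eq_zero]
    norm_cast
  rw [hzero]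
  change (∃ n m, _ ∧ w = word n m) ↔ _
  simp only [hw]
  constructor
  · rintro ⟨n, m, hp, hs, h1, h2⟩
    simp only [h1, h2]
    exact ⟨hs, hp⟩
  · rintro ⟨hs, h⟩
    exact ⟨_, _, h, hs, fun _ => rfl, fun _ => rfl⟩

end

/-! ### Unitary dilations -/

open scoped MatrixOrder Matrix.Norms.L2Operator in
/-- Every square matrix is a contraction up to a positive factor, which completes to an isometry. -/
theorem exists_conjTranspose_mul_add_eq_one {W : Type*} [Fintype W] [DecidableEq W]
    (B : Matrix W W ℂ) : ∃ (c : ℝ) (C : Matrix W W ℂ), 0 < c ∧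
      ((c : ℂ) • B).conjTranspose * ((c : ℂ) • B) + C.conjTranspose * C = 1 := by
  -- The `+ 1` keeps the scale invertible when `B = 0`. The difference of the two sides is positive,
  -- hence of the form `star D * D`.
  have h1 : star B * B ≤ algebraMap ℝ (Matrix W W ℂ) ((‖B‖ + 1) ^ 2) :=
    CStarAlgebra.star_mul_le_algebraMap_norm_sq.trans
      (algebraMap_mono _ (by gcongr; linarith))
  obtain ⟨D, hD⟩ := CStarAlgebra.nonneg_iff_eq_star_mul_self.1 (sub_nonneg.2 h1)
  have hpos : 0 < ‖B‖ + 1 := by positivity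
  have hne : ((‖B‖ + 1 : ℝ) : ℂ) ≠ 0 := by exact_mod_cast hpos.ne'
  refine ⟨(‖B‖ + 1)⁻¹, (((‖B‖ + 1)⁻¹ : ℝ) : ℂ) • D, inv_pos.2 hpos, ?_⟩
  have hsum : B.conjTranspose * B + D.conjTranspose * D =
      (((‖B‖ + 1 : ℝ) : ℂ) ^ 2) • (1 : Matrix W W ℂ) := by
    rw [← Matrix.star_eq_conjTranspose, ← Matrix.star_eq_conjTranspose, ← hD, add_sub_cancel,
      Algebra.algebraMap_eq_smul_one]
    ext i j
    simp [Matrix.smul_apply]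
  simp only [Matrix.conjTranspose_smul, Matrix.smul_mul, Matrix.mul_smul, smul_smul, ← smul_add,
    hsum]
  simp only [Complex.star_def, Complex.conj_ofReal]
  rw [Complex.ofReal_inv]
  rw [show ((‖B‖ + 1 : ℝ) : ℂ)⁻¹ * ((‖B‖ + 1 : ℝ) : ℂ)⁻¹ * ((‖B‖ + 1 : ℝ) : ℂ) ^ 2 = 1 by
    field_simp, one_smul]

/-- Up to a positive factor, every square matrix is a block of a unitary matrix of twice the
size. -/
theorem exists_unitary_dilation {W : Type*} [Fintype W] [DecidableEq W] (B : Matrix W W ℂ) :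
    ∃ (c : ℝ) (U : Matrix.unitaryGroup (W ⊕ W) ℂ), 0 < c ∧
      ∀ i j, (U : Matrix (W ⊕ W) (W ⊕ W) ℂ) (.inl i) (.inl j) = c * B i j := by
  obtain ⟨c, C, hc, hC⟩ := exists_conjTranspose_mul_add_eq_one B
  let v : W ⊕ W → EuclideanSpace ℂ (W ⊕ W) := Sum.elim
    (fun j => WithLp.toLp 2 (Sum.elim (fun i => c * B i j) (fun i => C i j))) 0
  -- The identity for `C` says exactly that the columns of `c • B` stacked on `C` are orthonormal.
  -- They extend to an orthonormal basis, whose vectors are the columns of the unitary matrix.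
  have hv : Orthonormal ℂ ((Set.range Sum.inl).domRestrict v) := by
    rw [orthonormal_iff_ite]
    rintro ⟨_, j, rfl⟩ ⟨_, k, rfl⟩
    have := congrFun (congrFun hC j) k
    simp only [Matrix.add_apply, Matrix.mul_apply, Matrix.conjTranspose_apply, Matrix.smul_apply,
      smul_eq_mul, Matrix.one_apply] at this
    simpa [v, EuclideanSpace.inner_eq_star_dotProduct, dotProduct, mul_comm, Subtype.ext_iff] using this
  obtain ⟨b, hb⟩ := hv.exists_orthonormalBasis_extension_of_card_eq (by simp)
  refine ⟨c, ⟨_, (EuclideanSpace.basisFun (W ⊕ W) ℂ).toMatrix_orthonormalBasis_mem_unitary b⟩, hc,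
    fun i j => ?_⟩
  simp [Module.Basis.toMatrix_apply, hb _ ⟨j, rfl⟩, v]

/-! ### Integer representations -/

theorem exists_common_denominator {κ : Type*} [Finite κ] (x : κ → ℚ) :
    ∃ (D : ℤ) (z : κ → ℤ), 0 < D ∧ ∀ k, (z k : ℚ) = D * x k := by
  have := Fintype.ofFinite κ
  refine ⟨∏ k, ((x k).den : ℤ), fun k => (∏ k, ((x k).den : ℤ)) / (x k).den * (x k).num,
    Finset.prod_pos fun k _ => by exact_mod_cast (x k).den_pos, fun k => ?_⟩
  obtain ⟨q, hq⟩ : ((x k).den : ℤ) ∣ ∏ k, ((x k).den : ℤ) :=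
    Finset.dvd_prod_of_mem _ (Finset.mem_univ k)
  have hden : ((x k).den : ℤ) ≠ 0 := by exact_mod_cast (x k).den_ne_zero
  dsimp only
  rw [hq, Int.mul_ediv_cancel_left _ hden]
  have := Rat.den_mul_eq_num (x k)
  push_cast
  rw [← this]
  ring

/-- The zero set of a rational series is the zero set of a series with an integer matrix
representation. -/
theorem IsSeriesZeroSet.exists_integer_representation {α : Type*} {L : Language α}
    (h : IsSeriesZeroSet L) : ∃ (n : ℕ) (N : α → Matrix (Fin n) (Fin n) ℤ) (z : Fin n → ℤ)
      (i₀ : Fin n), ∀ w : List α, w ∈ L ↔ w.foldr (fun a v => (N a).mulVec v) z i₀ = 0 := by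
  obtain ⟨f, hf, hL⟩ := h
  obtain ⟨n, b, A, i₀, hb, rfl⟩ := exists_family_of_mem_rationalSeries hf
  obtain ⟨D₀, z, hD₀, hz⟩ := exists_common_denominator fun i => b i []
  choose D N hD hN using fun a =>
    exists_common_denominator fun p : Fin n × Fin n => A a p.1 p.2
  -- Each letter contributes one common denominator for its whole matrix, so the accumulated factor
  -- `E` is the same for all coordinates.
  have key : ∀ w : List α, ∃ E : ℤ, 0 < E ∧ ∀ i, ((w.foldr
      (fun a v => (Matrix.of fun i j => N a (i, j)).mulVec v) z i : ℤ) : ℚ) = E * b i w := by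
    intro w
    induction w with
    | nil => exact ⟨D₀, hD₀, hz⟩
    | cons a w ih =>
      obtain ⟨E, hE, hi⟩ := ih
      refine ⟨D a * E, mul_pos (hD a) hE, fun i => ?_⟩
      simp only [List.foldr_cons, Matrix.mulVec, dotProduct, Int.cast_sum, Int.cast_mul, hi,
        Matrix.of_apply, hN, hb, Finset.mul_sum]
      exact Finset.sum_congr rfl fun j _ => by ring
  refine ⟨n, fun a => Matrix.of fun i j => N a (i, j), z, i₀, fun w => ?_⟩
  obtain ⟨E, hE, hi⟩ := key w
  rw [hL, ← Int.cast_eq_zero (α := ℚ), hi]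
  have : (E : ℚ) ≠ 0 := by exact_mod_cast hE.ne'
  simp [this]

/-! ### General facts about one-way quantum automata with restart -/

theorem sum_norm_sq_unitary_mulVec {Q : Type*} [Fintype Q] [DecidableEq Q]
    (U : Matrix.unitaryGroup Q ℂ) (ψ : Q → ℂ) :
    ∑ q, ‖((U : Matrix Q Q ℂ).mulVec ψ) q‖ ^ 2 = ∑ q, ‖ψ q‖ ^ 2 := by
  have h : ∀ φ : Q → ℂ, ((∑ q, ‖φ q‖ ^ 2 : ℝ) : ℂ) = star φ ⬝ᵥ φ := by
    intro φ
    simp [dotProduct, Complex.conj_mul']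
  have hU : (U : Matrix Q Q ℂ).conjTranspose * (U : Matrix Q Q ℂ) = 1 :=
    Matrix.mem_unitaryGroup_iff'.1 U.2
  apply Complex.ofReal_injective
  rw [h, h, Matrix.star_mulVec, Matrix.dotProduct_mulVec, Matrix.vecMul_vecMul, hU,
    Matrix.vecMul_one]

namespace OneQFARestart

variable {Q Q' α : Type*} [Fintype Q] [DecidableEq Q] [Fintype Q'] [DecidableEq Q']

theorem outcomeFrom_nonneg (M : OneQFARestart Q α) (A : Finset Q) (u : List (TapeSymbol α))
    (ψ : Q → ℂ) : 0 ≤ M.outcomeFrom A u ψ := by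
  induction u generalizing ψ with
  | nil => exact le_rfl
  | cons σ u ih => exact add_nonneg (Finset.sum_nonneg fun _ _ => by positivity) (ih _)

/-- The probabilities of the outcomes of a scan and of not having halted add up to `1`. -/
theorem outcomeFrom_add (M : OneQFARestart Q α) (u : List (TapeSymbol α)) (ψ : Q → ℂ) :
    M.outcomeFrom M.acc u ψ + M.outcomeFrom M.rej u ψ + M.outcomeFrom M.restart u ψ +
      ∑ q, ‖u.foldl (fun ψ σ => continueStep (M.U σ) (M.acc ∪ M.rej ∪ M.restart) ψ) ψ q‖ ^ 2 =
    ∑ q, ‖ψ q‖ ^ 2 := by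
  induction u generalizing ψ with
  | nil => simp [outcomeFrom]
  | cons σ u ih =>
    have h1 := ih (continueStep (M.U σ) (M.acc ∪ M.rej ∪ M.restart) ψ)
    have h2 : ∀ φ : Q → ℂ, ∑ q ∈ M.acc, ‖φ q‖ ^ 2 + ∑ q ∈ M.rej, ‖φ q‖ ^ 2 +
        ∑ q ∈ M.restart, ‖φ q‖ ^ 2 +
        ∑ q, ‖(if q ∈ M.acc ∪ M.rej ∪ M.restart then 0 else φ q)‖ ^ 2 = ∑ q, ‖φ q‖ ^ 2 := by
      intro φ
      rw [← Finset.sum_union M.disjoint_acc_rej, ← Finset.sum_union (Finset.disjoint_union_left.2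
        ⟨M.disjoint_acc_restart, M.disjoint_rej_restart⟩),
        ← Finset.sum_add_sum_compl (M.acc ∪ M.rej ∪ M.restart) fun q => ‖φ q‖ ^ 2]
      congr 1
      rw [← Finset.sum_add_sum_compl (M.acc ∪ M.rej ∪ M.restart), Finset.sum_eq_zero, zero_add]
      · exact Finset.sum_congr rfl fun q hq => by rw [if_neg (Finset.mem_compl.1 hq)]
      · intro q hq
        rw [if_pos hq]
        simp
    have h3 := h2 ((M.U σ : Matrix Q Q ℂ).mulVec ψ)
    rw [sum_norm_sq_unitary_mulVec] at h3
    simp only [outcomeFrom, List.foldl_cons]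
    change _ + _ + _ + ∑ q, ‖continueStep (M.U σ) (M.acc ∪ M.rej ∪ M.restart) ψ q‖ ^ 2 = _ at h3
    linarith

theorem roundAcc_add_roundRej_add_roundRestart (M : OneQFARestart Q α) (w : List α) :
    M.roundAcc w + M.roundRej w + M.roundRestart w = 1 := by
  have h := M.outcomeFrom_add (tape w) (Pi.single M.init 1)
  rw [M.round_ends] at h
  have h1 : ∑ q, ‖(Pi.single M.init 1 : Q → ℂ) q‖ ^ 2 = 1 := by
    rw [Finset.sum_eq_single M.init] <;> simp +contextual
  simpa [h1, roundAcc, roundRej, roundRestart] using h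

theorem roundRestart_nonneg (M : OneQFARestart Q α) (w : List α) : 0 ≤ M.roundRestart w :=
  M.outcomeFrom_nonneg _ _ _

/-- The geometric series conditions on the round not being restarted; any factor common to
acceptance and rejection thus cancels. -/
theorem tsum_roundRestart_pow_mul (M : OneQFARestart Q α) {w : List α}
    (h : 0 < M.roundAcc w + M.roundRej w) (x : ℝ) :
    ∑' i : ℕ, M.roundRestart w ^ i * x = x / (M.roundAcc w + M.roundRej w) := by
  have h1 := M.roundAcc_add_roundRej_add_roundRestart w
  rw [tsum_mul_right, tsum_geometric_of_lt_one (M.roundRestart_nonneg w) (by linarith),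
    show 1 - M.roundRestart w = M.roundAcc w + M.roundRej w by linarith, div_eq_inv_mul]

/-! ### Exchanging verdicts and renaming states -/

/-- The automaton with accepting and rejecting states exchanged. -/
def swap (M : OneQFARestart Q α) : OneQFARestart Q α where
  U := M.U
  init := M.init
  acc := M.rej
  rej := M.acc
  restart := M.restart
  disjoint_acc_rej := M.disjoint_acc_rej.symm
  disjoint_acc_restart := M.disjoint_rej_restart
  disjoint_rej_restart := M.disjoint_acc_restart
  init_non := by rw [Finset.union_comm M.rej]; exact M.init_non
  round_ends := by rw [Finset.union_comm M.rej]; exact M.round_ends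

theorem swap_outcomeFrom (M : OneQFARestart Q α) (A : Finset Q) (u : List (TapeSymbol α))
    (ψ : Q → ℂ) : M.swap.outcomeFrom A u ψ = M.outcomeFrom A u ψ := by
  induction u generalizing ψ with
  | nil => rfl
  | cons σ u ih =>
    simp only [outcomeFrom, ih]
    simp only [swap, Finset.union_comm M.rej]

theorem RecognizesNegative.swap {M : OneQFARestart Q α} {L : Language α} {ε : ℝ}
    (h : M.RecognizesNegative L ε) : M.swap.RecognizesPositive Lᶜ ε := by
  have h1 : M.swap.acceptProb = M.rejectProb := by
    ext w
    simp only [acceptProb, rejectProb, roundRestart, roundAcc, roundRej, swap_outcomeFrom]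
    rfl
  have h2 : M.swap.rejectProb = M.acceptProb := by
    ext w
    simp only [acceptProb, rejectProb, roundRestart, roundAcc, roundRej, swap_outcomeFrom]
    rfl
  refine ⟨fun w hw => ?_, fun w hw => ?_⟩
  · rw [h1]; exact h.2 w hw
  · rw [h2]; exact h.1 w (not_not.1 hw)

/-- Renaming the basis vectors of a unitary matrix. -/
def mapUnitary (e : Q ≃ Q') (U : Matrix.unitaryGroup Q ℂ) : Matrix.unitaryGroup Q' ℂ :=
  ⟨(U : Matrix Q Q ℂ).submatrix e.symm e.symm, by
    rw [Matrix.mem_unitaryGroup_iff, Matrix.star_eq_conjTranspose, Matrix.conjTranspose_submatrix,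
      Matrix.submatrix_mul_equiv, ← Matrix.star_eq_conjTranspose,
      Matrix.mem_unitaryGroup_iff.1 U.2, Matrix.submatrix_one_equiv]⟩

theorem continueStep_mapUnitary (e : Q ≃ Q') (U : Matrix.unitaryGroup Q ℂ)
    (H : Finset Q) (ψ : Q → ℂ) :
    continueStep (mapUnitary e U) (H.map e.toEmbedding) (ψ ∘ e.symm) = continueStep U H ψ ∘ e.symm := by
  ext q
  simp [continueStep, mapUnitary, Matrix.submatrix_mulVec_equiv, Function.comp_assoc,
    Finset.mem_map_equiv]

/-- Renaming the states of an automaton. -/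
def mapStates (M : OneQFARestart Q α) (e : Q ≃ Q') : OneQFARestart Q' α where
  U σ := mapUnitary e (M.U σ)
  init := e M.init
  acc := M.acc.map e.toEmbedding
  rej := M.rej.map e.toEmbedding
  restart := M.restart.map e.toEmbedding
  disjoint_acc_rej := (Finset.disjoint_map _).2 M.disjoint_acc_rej
  disjoint_acc_restart := (Finset.disjoint_map _).2 M.disjoint_acc_restart
  disjoint_rej_restart := (Finset.disjoint_map _).2 M.disjoint_rej_restart
  init_non := by
    rw [← Finset.map_union, ← Finset.map_union, Finset.mem_map_equiv, e.symm_apply_apply]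
    exact M.init_non
  round_ends w := by
    have h1 : (Pi.single (e M.init) 1 : Q' → ℂ) = Pi.single M.init 1 ∘ e.symm := by
      ext q
      simp [Pi.single_apply, Equiv.symm_apply_eq]
    have h2 : ∀ (u : List (TapeSymbol α)) (ψ : Q → ℂ), u.foldl (fun ψ σ => continueStep
        (mapUnitary e (M.U σ)) ((M.acc ∪ M.rej ∪ M.restart).map e.toEmbedding) ψ) (ψ ∘ e.symm) =
        u.foldl (fun ψ σ => continueStep (M.U σ) (M.acc ∪ M.rej ∪ M.restart) ψ) ψ ∘ e.symm := by
      intro u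
      induction u with
      | nil => intro ψ; rfl
      | cons σ u ih =>
        intro ψ
        rw [List.foldl_cons, List.foldl_cons, ← ih, continueStep_mapUnitary]
    rw [← Finset.map_union, ← Finset.map_union, h1, h2, M.round_ends]
    rfl

theorem mapStates_outcomeFrom (M : OneQFARestart Q α) (e : Q ≃ Q') (A : Finset Q)
    (u : List (TapeSymbol α)) (ψ : Q → ℂ) :
    (M.mapStates e).outcomeFrom (A.map e.toEmbedding) u (ψ ∘ e.symm) = M.outcomeFrom A u ψ := by
  induction u generalizing ψ with
  | nil => rfl
  | cons σ u ih =>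
    have h := continueStep_mapUnitary e (M.U σ) (M.acc ∪ M.rej ∪ M.restart) ψ
    rw [Finset.map_union, Finset.map_union] at h
    simp only [outcomeFrom, ← ih]
    rw [← h]
    simp [mapStates, mapUnitary, Matrix.submatrix_mulVec_equiv, Function.comp_assoc]

theorem RecognizesNegative.mapStates {M : OneQFARestart Q α} {L : Language α} {ε : ℝ}
    (h : M.RecognizesNegative L ε) (e : Q ≃ Q') : (M.mapStates e).RecognizesNegative L ε := by
  have h0 : (Pi.single (e M.init) 1 : Q' → ℂ) = Pi.single M.init 1 ∘ e.symm := by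
    ext q
    simp [Pi.single_apply, Equiv.symm_apply_eq]
  have h1 : ∀ (A : Finset Q) (w : List α), (M.mapStates e).outcomeFrom (A.map e.toEmbedding)
      (tape w) (Pi.single (M.mapStates e).init 1) =
        M.outcomeFrom A (tape w) (Pi.single M.init 1) := by
    intro A w
    rw [← M.mapStates_outcomeFrom e, ← h0]
    rfl
  have hA : (M.mapStates e).roundAcc = M.roundAcc := funext (h1 M.acc)
  have hR : (M.mapStates e).roundRej = M.roundRej := funext (h1 M.rej)
  have hS : (M.mapStates e).roundRestart = M.roundRestart := funext (h1 M.restart)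
  simpa only [RecognizesNegative, acceptProb, rejectProb, hA, hR, hS] using h

end OneQFARestart

/-! ### The quantum automaton of an integer representation -/

section

variable {α : Type*} {n : ℕ}

/-- The transitions, up to a factor, of the quantum automaton of the representation `N`, `z`, `i₀`.
Of the three states in the second summand, the first one keeps a constant amplitude, which becomes
the amplitude of the second one, the accepting state, at the right end-marker; the value of the
series becomes the amplitude of the third one, the rejecting state. -/
def seriesAmplitude (N : α → Matrix (Fin n) (Fin n) ℤ) (z : Fin n → ℤ) (i₀ : Fin n) (η : ℝ) :
    TapeSymbol α → Matrix (Fin n ⊕ Fin 3) (Fin n ⊕ Fin 3) ℂ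
  | .leftEnd => Matrix.fromBlocks 0 (Matrix.of fun i => ![if i = i₀ then 1 else 0, 0, 0]) 0
      !![1, 0, 0; 0, 0, 0; 0, 0, 0]
  -- The transpose makes the amplitudes evolve as a row vector multiplied by `N a` on the right, so
  -- letters read from left to right build the matrix product in the correct order.
  | .letter a => Matrix.fromBlocks ((N a).map (Int.castRingHom ℂ)).transpose 0 0
      !![1, 0, 0; 0, 0, 0; 0, 0, 0]
  | .rightEnd => Matrix.fromBlocks 0 0 (Matrix.of ![0, 0, fun i => (z i : ℂ)])
      !![0, 0, 0; (η : ℂ), 0, 0; 0, 0, 0]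

/-- The states of the quantum automaton of an integer representation; those of the second summand
are the restart states. -/
abbrev SeriesStates (n : ℕ) : Type := (Fin n ⊕ Fin 3) ⊕ (Fin n ⊕ Fin 3)

/-- The superposition with amplitudes `v` and, at the constant state, `x`. -/
def seriesState (v : Fin n → ℂ) (x : ℂ) : SeriesStates n → ℂ :=
  Sum.elim (Sum.elim v ![x, 0, 0]) 0

/-- The halting states of the quantum automaton of an integer representation. -/
def seriesHalting : Finset (SeriesStates n) :=
  {.inl (.inr 1)} ∪ {.inl (.inr 2)} ∪ Finset.univ.map Function.Embedding.inr

theorem mulVec_sumElim_zero_inl {W : Type*} [Fintype W] [DecidableEq W]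
    {U : Matrix (W ⊕ W) (W ⊕ W) ℂ} {c : ℝ} {B : Matrix W W ℂ}
    (hU : ∀ i j, U (.inl i) (.inl j) = c * B i j) (y : W → ℂ) (p : W) :
    U.mulVec (Sum.elim y 0) (.inl p) = c * B.mulVec y p := by
  simp [Matrix.mulVec, dotProduct, hU, Finset.mul_sum, mul_assoc]

variable {N : α → Matrix (Fin n) (Fin n) ℤ} {z : Fin n → ℤ} {i₀ : Fin n} {η : ℝ}

theorem seriesAmplitude_leftEnd_mulVec :
    (seriesAmplitude N z i₀ η .leftEnd).mulVec (Sum.elim 0 ![1, 0, 0]) =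
      Sum.elim (Pi.single i₀ 1) ![1, 0, 0] := by
  ext p
  rcases p with i | x
  · simp [seriesAmplitude, Matrix.mulVec, dotProduct, Fin.sum_univ_three, Pi.single_apply]
  · fin_cases x <;> simp [seriesAmplitude, Matrix.mulVec, dotProduct,
      Fin.sum_univ_three]

theorem seriesAmplitude_letter_mulVec (a : α) (v : Fin n → ℂ) (x : ℂ) :
    (seriesAmplitude N z i₀ η (.letter a)).mulVec (Sum.elim v ![x, 0, 0]) =
      Sum.elim (Matrix.vecMul v ((N a).map (Int.castRingHom ℂ))) ![x, 0, 0] := by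
  ext p
  rcases p with i | y
  · simp [seriesAmplitude, Matrix.fromBlocks_mulVec, ← Matrix.mulVec_transpose]
  · fin_cases y <;> simp [seriesAmplitude, Matrix.mulVec, dotProduct,
      Fin.sum_univ_three]

theorem seriesAmplitude_rightEnd_mulVec (v : Fin n → ℂ) (x : ℂ) :
    (seriesAmplitude N z i₀ η .rightEnd).mulVec (Sum.elim v ![x, 0, 0]) =
      Sum.elim (0 : Fin n → ℂ) ![0, η * x, v ⬝ᵥ fun i => (z i : ℂ)] := by
  ext p
  rcases p with i | y
  · simp [seriesAmplitude, Matrix.fromBlocks_mulVec]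
  · fin_cases y <;> simp [seriesAmplitude, Matrix.mulVec, dotProduct,
      Fin.sum_univ_three, mul_comm]

variable {U : TapeSymbol α → Matrix.unitaryGroup (SeriesStates n) ℂ}
  {c : TapeSymbol α → ℝ}

/-- The restart half, where the dilation puts the lost amplitude, is projected away together with
the two verdict states; the surviving state has the same shape. -/
theorem continueStep_seriesState_of_mulVec {σ : TapeSymbol α}
    (hU : ∀ i j, (U σ).1 (.inl i) (.inl j) = c σ * seriesAmplitude N z i₀ η σ i j)
    {v v' : Fin n → ℂ} {x x' y y' : ℂ}
    (h : (seriesAmplitude N z i₀ η σ).mulVec (Sum.elim v ![x, 0, 0]) = Sum.elim v' ![x', y, y']) :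
    continueStep (U σ) seriesHalting (seriesState v x) =
      seriesState ((c σ : ℂ) • v') (c σ * x') := by
  ext p
  rcases p with p | p
  · simp only [continueStep, seriesState, mulVec_sumElim_zero_inl hU, h]
    rcases p with i | p
    · simp [seriesHalting]
    · fin_cases p <;> simp [seriesHalting]
  · simp [continueStep, seriesHalting, seriesState]

theorem foldl_continueStep_seriesState
    (hU : ∀ σ i j, (U σ).1 (.inl i) (.inl j) = c σ * seriesAmplitude N z i₀ η σ i j)
    (w : List α) (v : Fin n → ℂ) (x : ℂ) :
    (w.map TapeSymbol.letter ++ [TapeSymbol.rightEnd]).foldl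
      (fun ψ σ => continueStep (U σ) seriesHalting ψ) (seriesState v x) = 0 := by
  induction w generalizing v x with
  | nil =>
    simp only [List.map_nil, List.nil_append, List.foldl_cons, List.foldl_nil]
    rw [continueStep_seriesState_of_mulVec (hU _) (seriesAmplitude_rightEnd_mulVec v x)]
    ext p
    rcases p with (i | p) | p
    · simp [seriesState]
    · fin_cases p <;> simp [seriesState]
    · simp [seriesState]
  | cons a w ih =>
    simp only [List.map_cons, List.cons_append, List.foldl_cons]
    rw [continueStep_seriesState_of_mulVec (hU _) (seriesAmplitude_letter_mulVec a v x), ih]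

theorem single_eq_seriesState : (Pi.single (.inl (.inr 0)) 1 :
    SeriesStates n → ℂ) = seriesState 0 1 := by
  ext p
  rcases p with (i | p) | p
  · simp [seriesState]
  · fin_cases p <;> simp [seriesState]
  · simp [seriesState]

/-- The quantum automaton with restart of an integer representation. -/
def seriesQFA (U : TapeSymbol α → Matrix.unitaryGroup (SeriesStates n) ℂ)
    (hU : ∀ σ i j, (U σ).1 (.inl i) (.inl j) = c σ * seriesAmplitude N z i₀ η σ i j) :
    OneQFARestart (SeriesStates n) α where
  U := U
  init := .inl (.inr 0)
  acc := {.inl (.inr 1)}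
  rej := {.inl (.inr 2)}
  restart := Finset.univ.map Function.Embedding.inr
  disjoint_acc_rej := by simp
  disjoint_acc_restart := by simp
  disjoint_rej_restart := by simp
  init_non := by simp
  round_ends w := by
    rw [single_eq_seriesState, tape, List.foldl_cons]
    erw [continueStep_seriesState_of_mulVec (hU _) seriesAmplitude_leftEnd_mulVec]
    exact foldl_continueStep_seriesState hU w _ _

/-- Every dilation factor `c σ` multiplies the constant amplitude and the vector `v` alike, so a
single `κ`, a product of the squares of these factors, serves both outcomes. The induction moves `N
a` from `v` to the vector of series values. -/
theorem seriesQFA_outcomeFrom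
    (hU : ∀ σ i j, (U σ).1 (.inl i) (.inl j) = c σ * seriesAmplitude N z i₀ η σ i j)
    (hc : ∀ σ, 0 < c σ) (w : List α) : ∃ κ : ℝ, 0 < κ ∧ ∀ v x,
      (seriesQFA U hU).outcomeFrom {.inl (.inr 1)}
        (w.map TapeSymbol.letter ++ [TapeSymbol.rightEnd]) (seriesState v x) =
          κ * (η ^ 2 * ‖x‖ ^ 2) ∧
      (seriesQFA U hU).outcomeFrom {.inl (.inr 2)}
        (w.map TapeSymbol.letter ++ [TapeSymbol.rightEnd]) (seriesState v x) =
          κ * ‖v ⬝ᵥ fun i => ((w.foldr (fun a v => (N a).mulVec v) z i : ℤ) : ℂ)‖ ^ 2 := by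
  induction w with
  | nil =>
    refine ⟨c .rightEnd ^ 2, pow_pos (hc _) 2, fun v x => ?_⟩
    have h : ∀ p, ((U .rightEnd).1.mulVec (seriesState v x)) (.inl p) = _ :=
      mulVec_sumElim_zero_inl (hU .rightEnd) _
    rw [seriesAmplitude_rightEnd_mulVec] at h
    constructor <;>
    simp [OneQFARestart.outcomeFrom, seriesQFA, h, mul_pow]
  | cons a w ih =>
    obtain ⟨κ, hκ, ih⟩ := ih
    refine ⟨c (.letter a) ^ 2 * κ, mul_pos (pow_pos (hc _) 2) hκ, fun v x => ?_⟩
    have h : ∀ p, ((U (.letter a)).1.mulVec (seriesState v x)) (.inl p) = _ :=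
      mulVec_sumElim_zero_inl (hU (.letter a)) _
    rw [seriesAmplitude_letter_mulVec] at h
    have hs := continueStep_seriesState_of_mulVec (hU _) (seriesAmplitude_letter_mulVec a v x)
    have hrec : ∀ A : Finset (SeriesStates n),
        (seriesQFA U hU).outcomeFrom A
          ((a :: w).map TapeSymbol.letter ++ [TapeSymbol.rightEnd]) (seriesState v x) =
        ∑ q ∈ A, ‖((U (.letter a)).1.mulVec (seriesState v x)) q‖ ^ 2 +
        (seriesQFA U hU).outcomeFrom A (w.map TapeSymbol.letter ++ [TapeSymbol.rightEnd])
          (continueStep (U (.letter a)) seriesHalting (seriesState v x)) := fun _ => rfl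
    have hN : (fun i => (((a :: w).foldr (fun a v => (N a).mulVec v) z i : ℤ) : ℂ)) =
        ((N a).map (Int.castRingHom ℂ)).mulVec
          (fun i => ((w.foldr (fun a v => (N a).mulVec v) z i : ℤ) : ℂ)) := by
      ext i
      exact (Int.castRingHom ℂ).map_mulVec (N a) _ i
    rw [hrec, hrec, hs, (ih _ _).1, (ih _ _).2, hN, Matrix.dotProduct_mulVec, smul_dotProduct]
    constructor
    · simp [h, mul_pow]
      ring
    · simp [h, mul_pow]
      ring

/-- For an integer representation there are quantum automata with restart that accept, in a round,
with a probability proportional to `η ^ 2` and reject with a probability proportional to the square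
of the value of the series. -/
theorem exists_oneQFARestart_of_representation (N : α → Matrix (Fin n) (Fin n) ℤ) (z : Fin n → ℤ)
    (i₀ : Fin n) (η : ℝ) : ∃ M : OneQFARestart (SeriesStates n) α,
      ∀ w, ∃ κ : ℝ, 0 < κ ∧ M.roundAcc w = κ * η ^ 2 ∧
        M.roundRej w = κ * (w.foldr (fun a v => (N a).mulVec v) z i₀ : ℝ) ^ 2 := by
  choose c U hc hU using fun σ => exists_unitary_dilation (seriesAmplitude N z i₀ η σ)
  refine ⟨seriesQFA U hU, fun w => ?_⟩
  obtain ⟨κ, hκ, h⟩ := seriesQFA_outcomeFrom hU hc w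
  refine ⟨c .leftEnd ^ 2 * κ, mul_pos (pow_pos (hc _) 2) hκ, ?_⟩
  have h1 : ∀ p, ((U .leftEnd).1.mulVec (seriesState 0 1)) (.inl p) = _ :=
    mulVec_sumElim_zero_inl (hU .leftEnd) _
  rw [seriesAmplitude_leftEnd_mulVec] at h1
  have hs := continueStep_seriesState_of_mulVec (hU _)
    (seriesAmplitude_leftEnd_mulVec (N := N) (z := z) (i₀ := i₀) (η := η))
  have hrec : ∀ A : Finset (SeriesStates n),
      (seriesQFA U hU).outcomeFrom A (tape w) (Pi.single (.inl (.inr 0)) 1) =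
      ∑ q ∈ A, ‖((U .leftEnd).1.mulVec (seriesState 0 1)) q‖ ^ 2 +
      (seriesQFA U hU).outcomeFrom A (w.map TapeSymbol.letter ++ [TapeSymbol.rightEnd])
        (continueStep (U .leftEnd) seriesHalting (seriesState 0 1)) := by
    intro A
    rw [single_eq_seriesState]
    rfl
  change (seriesQFA U hU).outcomeFrom {.inl (.inr 1)} (tape w) (Pi.single (.inl (.inr 0)) 1) = _ ∧
    (seriesQFA U hU).outcomeFrom {.inl (.inr 2)} (tape w) (Pi.single (.inl (.inr 0)) 1) = _
  rw [hrec, hrec, hs, (h _ _).1, (h _ _).2, smul_dotProduct, single_dotProduct]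
  constructor
  · simp [h1]
    ring
  · simp [h1, mul_pow]
    ring

theorem IsSeriesZeroSet.exists_recognizesNegative {L : Language α} (h : IsSeriesZeroSet L) :
    ∃ m : ℕ, ∀ ε : ℝ, 0 < ε → ∃ M : OneQFARestart (Fin m) α, M.RecognizesNegative L ε := by
  obtain ⟨n, N, z, i₀, hL⟩ := h.exists_integer_representation
  refine ⟨Fintype.card (SeriesStates n), fun ε hε => ?_⟩
  -- Acceptance in a round is proportional to the square of this amplitude, that is, to `ε`.
  obtain ⟨M, hM⟩ := exists_oneQFARestart_of_representation N z i₀ (√ε)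
  refine ⟨M.mapStates (Fintype.equivFin _), OneQFARestart.RecognizesNegative.mapStates
    ⟨fun w hw => ?_, fun w hw => ?_⟩ _⟩ <;>
  obtain ⟨κ, hκ, ha, hr⟩ := hM w <;>
  rw [Real.sq_sqrt hε.le] at ha
  · rw [(hL w).1 hw, Int.cast_zero, zero_pow two_ne_zero, mul_zero] at hr
    have hpos : 0 < M.roundAcc w := by rw [ha]; positivity
    rw [OneQFARestart.acceptProb, M.tsum_roundRestart_pow_mul (by rwa [hr, add_zero]), hr,
      add_zero, div_self hpos.ne']
  -- Integrality gives the gap: a nonzero value has absolute value at least `1`.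
  · have hg : 1 ≤ (w.foldr (fun a v => (N a).mulVec v) z i₀ : ℝ) ^ 2 := by
      have := Int.one_le_abs (mt (hL w).2 hw)
      rw [one_le_sq_iff_one_le_abs]
      exact_mod_cast this
    set g := (w.foldr (fun a v => (N a).mulVec v) z i₀ : ℝ) ^ 2
    have hpos : 0 < M.roundAcc w + M.roundRej w := by rw [ha, hr]; positivity
    rw [OneQFARestart.rejectProb, M.tsum_roundRestart_pow_mul hpos, le_div_iff₀ hpos, ha, hr]
    -- This is `(1 - ε) * (ε + g) ≤ g`, multiplied by `κ` and rearranged.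
    have : 0 ≤ κ * (ε * ε + ε * (g - 1)) := by
      have := sub_nonneg.2 hg
      positivity
    nlinarith

end

/-! ### General facts about two-way automata with quantum and classical states -/

namespace QuantumOp

variable {Q : Type*} [Fintype Q] [DecidableEq Q]

/-- The branches of an operation preserve the total probability. -/
theorem sum_branch_norm_sq (o : QuantumOp Q) (ψ : Q → ℂ) :
    ∑ j, ∑ q, ‖(o.branch j).mulVec ψ q‖ ^ 2 = ∑ q, ‖ψ q‖ ^ 2 := by
  cases o with
  | unitary U =>
    change ∑ _j : Fin 1, ∑ q, ‖(U : Matrix Q Q ℂ).mulVec ψ q‖ ^ 2 = _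
    rw [Fin.sum_univ_one, sum_norm_sq_unitary_mulVec]
  | measurement k P hH hO hS =>
    change ∑ j : Fin k, ∑ q, ‖(P j).mulVec ψ q‖ ^ 2 = _
    have h : ∀ φ : Q → ℂ, ((∑ q, ‖φ q‖ ^ 2 : ℝ) : ℂ) = star φ ⬝ᵥ φ := by
      intro φ
      simp [dotProduct, Complex.conj_mul']
    apply Complex.ofReal_injective
    rw [Complex.ofReal_sum, h]
    have h1 : ∀ j, ((∑ q, ‖(P j).mulVec ψ q‖ ^ 2 : ℝ) : ℂ) = star ψ ⬝ᵥ (P j).mulVec ψ := by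
      intro j
      rw [h, Matrix.star_mulVec, Matrix.dotProduct_mulVec, Matrix.vecMul_vecMul, (hH j).eq, hO,
        if_pos rfl, Matrix.dotProduct_mulVec]
    simp_rw [h1]
    rw [← dotProduct_sum, ← Matrix.sum_mulVec, hS, Matrix.one_mulVec]

/-- The measurement that distinguishes the basis states by their labels. -/
def labelMeasurement {k : ℕ} (l : Q → Fin k) : QuantumOp Q :=
  .measurement k (fun i => Matrix.diagonal fun q => if l q = i then 1 else 0)
    (fun i => by
      rw [Matrix.isHermitian_diagonal_iff]
      intro q
      split_ifs <;> simp)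
    (fun i j => by
      rw [Matrix.diagonal_mul_diagonal]
      split_ifs with h
      · subst h
        simp
      · rw [← Matrix.diagonal_zero]
        congr 1
        ext q
        by_cases hi : l q = i
        · simp [hi, h]
        · simp [hi])
    (by
      ext p q
      by_cases h : p = q <;> simp [Matrix.sum_apply, Matrix.one_apply, h])

end QuantumOp

namespace TwoQCFA

variable {Q S S' α : Type*} [Fintype Q] [DecidableEq Q] [DecidableEq S] [DecidableEq S']

theorem haltWithin_nonneg (M : TwoQCFA Q S α) (w : List α) (A : Finset S) (t : ℕ) (s : S) (i : ℕ)
    (ψ : Q → ℂ) : 0 ≤ M.haltWithin w A t s i ψ := by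
  have h : ∀ ψ : Q → ℂ, 0 ≤ ∑ q, ‖ψ q‖ ^ 2 := fun ψ => Finset.sum_nonneg fun _ _ => by positivity
  induction t generalizing s i ψ with
  | zero =>
    rw [haltWithin]
    split_ifs
    exacts [h ψ, le_rfl]
  | succ t ih =>
    rw [haltWithin]
    split_ifs
    exacts [h ψ, le_rfl, Finset.sum_nonneg fun _ _ => ih _ _ _]

theorem haltWithin_le (M : TwoQCFA Q S α) (w : List α) (A : Finset S) (t : ℕ) (s : S) (i : ℕ)
    (ψ : Q → ℂ) : M.haltWithin w A t s i ψ ≤ ∑ q, ‖ψ q‖ ^ 2 := by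
  have h : ∀ ψ : Q → ℂ, 0 ≤ ∑ q, ‖ψ q‖ ^ 2 := fun ψ => Finset.sum_nonneg fun _ _ => by positivity
  induction t generalizing s i ψ with
  | zero =>
    rw [haltWithin]
    split_ifs
    exacts [le_rfl, h ψ]
  | succ t ih =>
    rw [haltWithin]
    split_ifs
    · exact le_rfl
    · exact h ψ
    · rw [← (M.Θ s (symbolAt w i)).sum_branch_norm_sq ψ]
      exact Finset.sum_le_sum fun _ _ => ih _ _ _

theorem haltWithin_of_mem (M : TwoQCFA Q S α) (w : List α) {A : Finset S}
    (hA : A ⊆ M.acc ∪ M.rej) (t : ℕ) {s : S} (hs : s ∈ A) (i : ℕ) (ψ : Q → ℂ) :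
    M.haltWithin w A t s i ψ = ∑ q, ‖ψ q‖ ^ 2 := by
  cases t with
  | zero => rw [haltWithin, if_pos hs]
  | succ t => rw [haltWithin, if_pos (hA hs), if_pos hs]

theorem haltWithin_mono (M : TwoQCFA Q S α) (w : List α) {A : Finset S}
    (hA : A ⊆ M.acc ∪ M.rej) {t t' : ℕ} (h : t ≤ t') (s : S) (i : ℕ) (ψ : Q → ℂ) :
    M.haltWithin w A t s i ψ ≤ M.haltWithin w A t' s i ψ := by
  induction t generalizing t' s i ψ with
  | zero =>
    rw [haltWithin]
    split_ifs with hs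
    · rw [M.haltWithin_of_mem w hA t' hs]
    · exact M.haltWithin_nonneg _ _ _ _ _ _
  | succ t ih =>
    obtain ⟨t', rfl⟩ : ∃ k, t' = k + 1 := ⟨t' - 1, by omega⟩
    rw [haltWithin, haltWithin]
    split_ifs
    exacts [le_rfl, le_rfl, Finset.sum_le_sum fun _ _ => ih (by omega) _ _ _]

/-- Homogeneity lets a round restarted with amplitude `c` count as a fresh run weighted by `‖c‖ ^
2`. -/
theorem haltWithin_smul (M : TwoQCFA Q S α) (w : List α) (A : Finset S) (t : ℕ) (s : S) (i : ℕ)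
    (c : ℂ) (ψ : Q → ℂ) :
    M.haltWithin w A t s i (c • ψ) = ‖c‖ ^ 2 * M.haltWithin w A t s i ψ := by
  induction t generalizing s i ψ with
  | zero =>
    simp only [haltWithin]
    split_ifs <;> simp [mul_pow, Finset.mul_sum]
  | succ t ih =>
    simp only [haltWithin, Matrix.mulVec_smul, ih]
    split_ifs <;> simp [mul_pow, Finset.mul_sum]

theorem haltWithin_succ_of_not_mem (M : TwoQCFA Q S α) (w : List α) (A : Finset S) (t : ℕ) {s : S}
    (hs : s ∉ M.acc ∪ M.rej) (i : ℕ) (ψ : Q → ℂ) :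
    M.haltWithin w A (t + 1) s i ψ = ∑ j : Fin (M.Θ s (symbolAt w i)).numOutcomes,
      M.haltWithin w A t (M.δ s (symbolAt w i) j).1 ((M.δ s (symbolAt w i) j).2.move i)
        (((M.Θ s (symbolAt w i)).branch j).mulVec ψ) := by
  rw [haltWithin, if_neg hs]

/-- Renaming the classical states of an automaton. -/
def mapStates (M : TwoQCFA Q S α) (e : S ≃ S') : TwoQCFA Q S' α where
  Θ s σ := M.Θ (e.symm s) σ
  δ s σ j := (e (M.δ (e.symm s) σ j).1, (M.δ (e.symm s) σ j).2)
  qInit := M.qInit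
  sInit := e M.sInit
  acc := M.acc.map e.toEmbedding
  rej := M.rej.map e.toEmbedding
  disjoint_acc_rej := (Finset.disjoint_map _).2 M.disjoint_acc_rej
  leftEnd_move _ j := M.leftEnd_move _ j
  rightEnd_move _ j := M.rightEnd_move _ j

theorem mapStates_haltWithin (M : TwoQCFA Q S α) (e : S ≃ S') (w : List α) (A : Finset S) (t : ℕ)
    (s : S') (i : ℕ) (ψ : Q → ℂ) :
    (M.mapStates e).haltWithin w (A.map e.toEmbedding) t s i ψ =
      M.haltWithin w A t (e.symm s) i ψ := by
  have hmem : s ∈ (M.mapStates e).acc ∪ (M.mapStates e).rej ↔ e.symm s ∈ M.acc ∪ M.rej := by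
    simp only [mapStates, ← Finset.map_union, Finset.mem_map_equiv]
  induction t generalizing s i ψ with
  | zero => simp only [haltWithin, Finset.mem_map_equiv]
  | succ t ih =>
    simp only [haltWithin, Finset.mem_map_equiv, hmem]
    congr 1
    refine Finset.sum_congr rfl fun j _ => ?_
    rw [ih _ _ _ (by simp only [mapStates, ← Finset.map_union, Finset.mem_map_equiv])]
    congr 1
    exact e.symm_apply_apply _

theorem Recognizes.mapStates {M : TwoQCFA Q S α} {L : Language α} {ε : ℝ} (h : M.Recognizes L ε)
    (e : S ≃ S') : (M.mapStates e).Recognizes L ε := by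
  have hA : ∀ (A : Finset S) w t, (M.mapStates e).haltWithin w (A.map e.toEmbedding) t
      (M.mapStates e).sInit 0 (Pi.single (M.mapStates e).qInit 1) =
        M.haltWithin w A t M.sInit 0 (Pi.single M.qInit 1) := by
    intro A w t
    rw [mapStates_haltWithin]
    congr 1
    exact e.symm_apply_apply _
  have h1 : (M.mapStates e).acceptProb = M.acceptProb :=
    funext fun w => iSup_congr fun t => hA M.acc w t
  have h2 : (M.mapStates e).rejectProb = M.rejectProb :=
    funext fun w => iSup_congr fun t => hA M.rej w t
  simpa only [Recognizes, h1, h2] using h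

/-- A recurrence for the halting probabilities bounds their supremum from below. -/
theorem tsum_le_iSup_haltWithin (M : TwoQCFA Q S α) (w : List α) (A : Finset S) {a r : ℝ}
    (ha : 0 ≤ a) (hr : 0 ≤ r) {T : ℕ}
    (h : ∀ t, a + r * M.haltWithin w A t M.sInit 0 (Pi.single M.qInit 1) ≤
      M.haltWithin w A (t + T) M.sInit 0 (Pi.single M.qInit 1)) :
    ∑' i : ℕ, r ^ i * a ≤ ⨆ t, M.haltWithin w A t M.sInit 0 (Pi.single M.qInit 1) := by
  have hbdd : BddAbove (Set.range fun t =>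
      M.haltWithin w A t M.sInit 0 (Pi.single M.qInit 1)) :=
    ⟨_, by rintro _ ⟨t, rfl⟩; exact M.haltWithin_le w A t _ _ _⟩
  have key : ∀ k : ℕ, ∃ t, ∑ i ∈ Finset.range k, r ^ i * a ≤
      M.haltWithin w A t M.sInit 0 (Pi.single M.qInit 1) := by
    intro k
    induction k with
    | zero => exact ⟨0, by simpa using M.haltWithin_nonneg _ _ _ _ _ _⟩
    | succ k ih =>
      obtain ⟨t, ht⟩ := ih
      refine ⟨t + T, le_trans ?_ (h t)⟩
      rw [Finset.sum_range_succ']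
      simp only [pow_succ', mul_assoc, ← Finset.mul_sum, pow_zero, one_mul]
      linarith [mul_le_mul_of_nonneg_left ht hr]
  refine Real.tsum_le_of_sum_range_le (fun i => by positivity) fun k => ?_
  obtain ⟨t, ht⟩ := key k
  exact ht.trans (le_ciSup hbdd t)

end TwoQCFA

/-! ### Simulation of one-way quantum automata with restart -/

/-- The classical states of the simulation. -/
inductive SimState (n : ℕ) : Type
  | read
  | measure
  | reset (q : Fin n)
  | rewind
  | accept
  | reject
  deriving DecidableEq, Fintype

namespace OneQFARestart

variable {n : ℕ} {α : Type*}

/-- The label of a basis state in the measurement of the simulation: the halting states are told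
apart, the others are not. -/
def simLabel (M : OneQFARestart (Fin n) α) (q : Fin n) : Fin (n + 1) :=
  if q ∈ M.acc ∪ M.rej ∪ M.restart then q.succ else 0

/-- The permutation matrix that exchanges two basis states. -/
def swapUnitary (p q : Fin n) : Matrix.unitaryGroup (Fin n) ℂ :=
  ⟨(1 : Matrix (Fin n) (Fin n) ℂ).submatrix (Equiv.swap p q) id, by
    rw [Matrix.mem_unitaryGroup_iff, Matrix.star_eq_conjTranspose, Matrix.conjTranspose_submatrix,
      ← Matrix.submatrix_mul _ _ _ _ _ Function.bijective_id, Matrix.conjTranspose_one,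
      Matrix.one_mul, Matrix.submatrix_one_equiv]⟩

/-- The quantum operation of the simulation. -/
def simOp (M : OneQFARestart (Fin n) α) : SimState n → TapeSymbol α → QuantumOp (Fin n)
  | .read, σ => .unitary (M.U σ)
  | .measure, _ => .labelMeasurement M.simLabel
  | .reset q, _ => .unitary (swapUnitary q M.init)
  | .rewind, _ => .unitary 1
  | .accept, _ => .unitary 1
  | .reject, _ => .unitary 1

/-- The state after the measurement found the halting state `q`. -/
def simOutcome (M : OneQFARestart (Fin n) α) (q : Fin n) : SimState n :=
  if q ∈ M.acc then .accept else if q ∈ M.rej then .reject else .reset q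

/-- The classical transition of the simulation. -/
def simNext (M : OneQFARestart (Fin n) α) :
    (s : SimState n) → (σ : TapeSymbol α) → Fin (M.simOp s σ).numOutcomes → SimState n × Direction
  | .read, _, _ => (.measure, .stay)
  -- Outcome `0`, "not halted", must not move the head beyond the right end-marker. The verdict
  -- chosen here is immaterial: the lower bounds use only that its contribution is nonnegative.
  | .measure, .rightEnd, j => (Fin.cases .reject M.simOutcome (j : Fin (n + 1)), .stay)
  | .measure, _, j =>
      Fin.cases (.read, .right) (fun q => (M.simOutcome q, .stay)) (j : Fin (n + 1))
  | .reset _, _, _ => (.rewind, .stay)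
  | .rewind, .leftEnd, _ => (.read, .stay)
  | .rewind, _, _ => (.rewind, .left)
  | .accept, _, _ => (.accept, .stay)
  | .reject, _, _ => (.reject, .stay)

/-- The two-way automaton which simulates the rounds of `M` one after the other. -/
def simulation (M : OneQFARestart (Fin n) α) : TwoQCFA (Fin n) (SimState n) α where
  Θ := M.simOp
  δ := M.simNext
  qInit := M.init
  sInit := .read
  acc := {.accept}
  rej := {.reject}
  disjoint_acc_rej := by simp
  leftEnd_move s j := by
    cases s <;> simp only [simNext, ne_eq, reduceCtorEq, not_false_eq_true]
    change Fin (n + 1) at j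
    exact Fin.cases (nofun : Direction.right ≠ .left) (fun q => (nofun : Direction.stay ≠ .left)) j
  rightEnd_move s j := by
    cases s <;> simp [simNext]

/-! ### Comparing a round with its simulation -/

variable (M : OneQFARestart (Fin n) α) (w : List α) {A : Finset (SimState n)}

theorem simulation_haltWithin_read (t i : ℕ) (ψ : Fin n → ℂ) :
    M.simulation.haltWithin w A (t + 1) .read i ψ = M.simulation.haltWithin w A t .measure i
      ((M.U (TwoQCFA.symbolAt w i) : Matrix _ _ ℂ).mulVec ψ) := by
  rw [TwoQCFA.haltWithin_succ_of_not_mem _ _ _ _ (by simp [simulation])]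
  exact Fin.sum_univ_one _

theorem simulation_haltWithin_reset (t i : ℕ) (q : Fin n) (a : ℂ) :
    M.simulation.haltWithin w A (t + 1) (.reset q) i (Pi.single q a) =
      M.simulation.haltWithin w A t .rewind i (Pi.single M.init a) := by
  rw [TwoQCFA.haltWithin_succ_of_not_mem _ _ _ _ (by simp [simulation])]
  refine (Fin.sum_univ_one _).trans ?_
  congr 1
  change ((1 : Matrix (Fin n) (Fin n) ℂ).submatrix (Equiv.swap q M.init)
    (Equiv.refl (Fin n))).mulVec (Pi.single q a) = _
  rw [Matrix.submatrix_mulVec_equiv, Matrix.one_mulVec]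
  ext p
  simp [Pi.single_apply, Equiv.swap_apply_eq_iff]

theorem symbolAt_zero : TwoQCFA.symbolAt w 0 = .leftEnd := rfl

theorem symbolAt_succ_ne_leftEnd (i : ℕ) : TwoQCFA.symbolAt w (i + 1) ≠ .leftEnd := by
  have : ∀ (v : List α) (i : ℕ), (v.map TapeSymbol.letter ++ [TapeSymbol.rightEnd]).getD i
      TapeSymbol.rightEnd ≠ .leftEnd := by
    intro v
    induction v with
    | nil => intro i; cases i <;> simp
    | cons a v ih =>
      intro i
      cases i with
      | zero => simp
      | succ i => simpa using ih i
  exact this w i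

/-- The head makes `i` moves to the left and then spends one stationary step on the left end-marker
to resume reading. -/
theorem simulation_haltWithin_rewind (t i : ℕ) (ψ : Fin n → ℂ) :
    M.simulation.haltWithin w A (t + i + 1) .rewind i ψ =
      M.simulation.haltWithin w A t .read 0 ψ := by
  induction i with
  | zero =>
    rw [TwoQCFA.haltWithin_succ_of_not_mem _ _ _ _ (by simp [simulation]), symbolAt_zero]
    refine (Fin.sum_univ_one _).trans ?_
    congr 1
    exact Matrix.one_mulVec ψ
  | succ i ih =>
    rw [TwoQCFA.haltWithin_succ_of_not_mem _ _ _ _ (by simp [simulation]), ← ih]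
    have hσ := symbolAt_succ_ne_leftEnd w i
    generalize TwoQCFA.symbolAt w (i + 1) = σ at hσ
    refine (Fin.sum_univ_one _).trans ?_
    have hψ : ((1 : Matrix.unitaryGroup (Fin n) ℂ) : Matrix _ _ ℂ).mulVec ψ = ψ :=
      Matrix.one_mulVec ψ
    cases σ with
    | leftEnd => exact absurd rfl hσ
    | letter a => exact congrArg _ hψ
    | rightEnd => exact congrArg _ hψ

/-- After the measurement of a restart state the next round begins. -/
theorem le_simulation_haltWithin_reset (hA : A ⊆ M.simulation.acc ∪ M.simulation.rej) (t : ℕ)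
    {i k : ℕ} (hi : i + 2 ≤ k) (q : Fin n) (a : ℂ) :
    ‖a‖ ^ 2 * M.simulation.haltWithin w A t .read 0 (Pi.single M.init 1) ≤
      M.simulation.haltWithin w A (t + k) (.reset q) i (Pi.single q a) := by
  -- One step resets the register and `i + 1` steps rewind; monotonicity absorbs the remaining time.
  refine le_trans (le_of_eq ?_)
    (TwoQCFA.haltWithin_mono _ w hA (show t + i + 1 + 1 ≤ t + k by omega) _ _ _)
  rw [simulation_haltWithin_reset, simulation_haltWithin_rewind, ← TwoQCFA.haltWithin_smul,
    ← Pi.single_smul]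
  simp

theorem labelMeasurement_branch_zero (φ : Fin n → ℂ) :
    (Matrix.diagonal fun q => if M.simLabel q = 0 then (1 : ℂ) else 0).mulVec φ =
      fun q => if q ∈ M.acc ∪ M.rej ∪ M.restart then 0 else φ q := by
  ext q
  rw [Matrix.mulVec_diagonal, simLabel]
  split_ifs <;> simp_all

theorem labelMeasurement_branch_succ {q : Fin n} (hq : q ∈ M.acc ∪ M.rej ∪ M.restart)
    (φ : Fin n → ℂ) :
    (Matrix.diagonal fun p => if M.simLabel p = q.succ then (1 : ℂ) else 0).mulVec φ =
      Pi.single q (φ q) := by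
  ext p
  rw [Matrix.mulVec_diagonal, simLabel, Pi.single_apply]
  by_cases h : p = q
  · subst h
    rw [if_pos hq]
    simp
  · by_cases hp : p ∈ M.acc ∪ M.rej ∪ M.restart
    · rw [if_pos hp]
      simp [h]
    · rw [if_neg hp, if_neg (Fin.succ_ne_zero q).symm]
      simp [h]

theorem simulation_haltWithin_measure (t i : ℕ) (φ : Fin n → ℂ) :
    M.simulation.haltWithin w A (t + 1) .measure i φ =
      (match TwoQCFA.symbolAt w i with
        | .rightEnd => M.simulation.haltWithin w A t .reject i
            (fun q => if q ∈ M.acc ∪ M.rej ∪ M.restart then 0 else φ q)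
        | _ => M.simulation.haltWithin w A t .read (i + 1)
            (fun q => if q ∈ M.acc ∪ M.rej ∪ M.restart then 0 else φ q)) +
      ∑ q : Fin n, M.simulation.haltWithin w A t (M.simOutcome q) i
        ((Matrix.diagonal fun p => if M.simLabel p = q.succ then (1 : ℂ) else 0).mulVec φ) := by
  rw [TwoQCFA.haltWithin_succ_of_not_mem _ _ _ _ (by simp [simulation]),
    ← labelMeasurement_branch_zero]
  generalize TwoQCFA.symbolAt w i = σ
  cases σ <;> exact Fin.sum_univ_succ _

/-- The halting states of `M` contribute to the halting probability of the simulation. -/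
theorem le_sum_simulation_haltWithin {B : Finset (Fin n)}
    (hB : A = {.accept} ∧ B = M.acc ∨ A = {.reject} ∧ B = M.rej) (t : ℕ) {i k : ℕ}
    (hi : i + 2 ≤ k) (φ : Fin n → ℂ) :
    ∑ q ∈ B, ‖φ q‖ ^ 2 + (∑ q ∈ M.restart, ‖φ q‖ ^ 2) *
        M.simulation.haltWithin w A t .read 0 (Pi.single M.init 1) ≤
      ∑ q : Fin n, M.simulation.haltWithin w A (t + k) (M.simOutcome q) i
        ((Matrix.diagonal fun p => if M.simLabel p = q.succ then (1 : ℂ) else 0).mulVec φ) := by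
  have hA : A ⊆ M.simulation.acc ∪ M.simulation.rej := by
    rcases hB with ⟨rfl, -⟩ | ⟨rfl, -⟩ <;> simp [simulation]
  have hnorm : ∀ (q : Fin n) (a : ℂ), ∑ p, ‖(Pi.single q a : Fin n → ℂ) p‖ ^ 2 = ‖a‖ ^ 2 := by
    intro q a
    rw [Finset.sum_eq_single q] <;> simp +contextual
  have hdB : Disjoint B M.restart := by
    rcases hB with ⟨-, rfl⟩ | ⟨-, rfl⟩
    exacts [M.disjoint_acc_restart, M.disjoint_rej_restart]
  rw [Finset.sum_mul]
  refine le_trans ?_ (Finset.sum_le_sum_of_subset_of_nonneg (Finset.subset_univ (B ∪ M.restart))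
    fun _ _ _ => TwoQCFA.haltWithin_nonneg _ _ _ _ _ _ _)
  rw [Finset.sum_union hdB]
  refine add_le_add (Finset.sum_le_sum fun q hq => ?_) (Finset.sum_le_sum fun q hq => ?_)
  · have hmem : q ∈ M.acc ∪ M.rej ∪ M.restart := by
      rcases hB with ⟨-, rfl⟩ | ⟨-, rfl⟩ <;> simp [hq]
    rw [M.labelMeasurement_branch_succ hmem, TwoQCFA.haltWithin_of_mem _ w hA, hnorm]
    rcases hB with ⟨rfl, rfl⟩ | ⟨rfl, rfl⟩
    · simp [simOutcome, hq]
    · simp [simOutcome, hq, Finset.disjoint_right.1 M.disjoint_acc_rej hq]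
  · rw [M.labelMeasurement_branch_succ (by simp [hq]), simOutcome,
      if_neg (Finset.disjoint_right.1 M.disjoint_acc_restart hq),
      if_neg (Finset.disjoint_right.1 M.disjoint_rej_restart hq)]
    exact M.le_simulation_haltWithin_reset w hA t hi q (φ q)

theorem eq_nil_of_append_rightEnd_cons_eq_tape {u v : List (TapeSymbol α)}
    (h : v ++ .rightEnd :: u = tape w) : u = [] := by
  rcases u.eq_nil_or_concat with rfl | ⟨u, x, rfl⟩
  · rfl
  · have h1 : (v ++ .rightEnd :: u) ++ [x] = (.leftEnd :: w.map .letter) ++ [.rightEnd] := by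
      simpa [tape] using h
    have h2 := List.append_inj_left' h1 rfl
    have h3 : (TapeSymbol.rightEnd : TapeSymbol α) ∈ .leftEnd :: w.map .letter := by
      rw [← h2]
      simp
    simp at h3

/-- Each tape symbol costs two steps, a unitary one and a measurement. The extra `w.length + 4`
covers reset and rewinding from any position, leaving at least `t` steps for the next round. -/
theorem le_simulation_haltWithin_read {B : Finset (Fin n)}
    (hB : A = {.accept} ∧ B = M.acc ∨ A = {.reject} ∧ B = M.rej) (t : ℕ)
    (u v : List (TapeSymbol α)) (h : v ++ u = tape w) (ψ : Fin n → ℂ) :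
    M.outcomeFrom B u ψ + M.outcomeFrom M.restart u ψ *
        M.simulation.haltWithin w A t .read 0 (Pi.single M.init 1) ≤
      M.simulation.haltWithin w A (t + (w.length + 4) + 2 * u.length) .read v.length ψ := by
  induction u generalizing v ψ with
  | nil => simpa [outcomeFrom] using TwoQCFA.haltWithin_nonneg _ _ _ _ _ _ _
  | cons σ u ih =>
    have hlen : v.length + (u.length + 1) = w.length + 2 := by
      have := congrArg List.length h
      simpa [tape] using this
    have hσ : TwoQCFA.symbolAt w v.length = σ := by
      rw [TwoQCFA.symbolAt, ← h]
      simp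
    rw [List.length_cons, show t + (w.length + 4) + 2 * (u.length + 1) =
      t + (w.length + 4 + 2 * u.length) + 1 + 1 by omega, simulation_haltWithin_read,
      simulation_haltWithin_measure, hσ]
    have h1 := M.le_sum_simulation_haltWithin w hB t
      (show v.length + 2 ≤ w.length + 4 + 2 * u.length by omega)
      ((M.U σ : Matrix _ _ ℂ).mulVec ψ)
    have h2 : M.outcomeFrom B u (continueStep (M.U σ) (M.acc ∪ M.rej ∪ M.restart) ψ) +
        M.outcomeFrom M.restart u (continueStep (M.U σ) (M.acc ∪ M.rej ∪ M.restart) ψ) *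
          M.simulation.haltWithin w A t .read 0 (Pi.single M.init 1) ≤
        (match (generalizing := false) σ with
        | .rightEnd => M.simulation.haltWithin w A (t + (w.length + 4 + 2 * u.length)) .reject
            v.length (continueStep (M.U σ) (M.acc ∪ M.rej ∪ M.restart) ψ)
        | _ => M.simulation.haltWithin w A (t + (w.length + 4 + 2 * u.length)) .read
            (v.length + 1) (continueStep (M.U σ) (M.acc ∪ M.rej ∪ M.restart) ψ)) := by
      have ih' := ih (v ++ [σ]) (by simpa using h)
        (continueStep (M.U σ) (M.acc ∪ M.rej ∪ M.restart) ψ)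
      rw [List.length_append, List.length_singleton, add_assoc t] at ih'
      cases σ with
      | leftEnd => exact ih'
      | letter a => exact ih'
      | rightEnd =>
        -- Nothing follows the right end-marker, so both outcome probabilities on the left are zero.
        obtain rfl := eq_nil_of_append_rightEnd_cons_eq_tape w h
        simpa [outcomeFrom] using TwoQCFA.haltWithin_nonneg _ _ _ _ _ _ _
    have h3 := add_le_add h2 h1
    refine le_trans (le_of_eq ?_) h3
    simp only [outcomeFrom]
    ring

theorem tsum_le_simulation {B : Finset (Fin n)}
    (hB : A = {.accept} ∧ B = M.acc ∨ A = {.reject} ∧ B = M.rej) :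
    ∑' i : ℕ, M.roundRestart w ^ i * M.outcomeFrom B (tape w) (Pi.single M.init 1) ≤
      ⨆ t, M.simulation.haltWithin w A t .read 0 (Pi.single M.init 1) := by
  refine M.simulation.tsum_le_iSup_haltWithin w A (M.outcomeFrom_nonneg _ _ _)
    (M.roundRestart_nonneg w) (T := w.length + 4 + 2 * (tape w).length) fun t => ?_
  rw [← add_assoc]
  exact M.le_simulation_haltWithin_read w hB t (tape w) [] rfl _

variable {M}

/-- Bounded error asks only for lower bounds on the halting probabilities, so the inequality
`tsum_le_simulation` suffices for both verdicts. -/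
theorem RecognizesNegative.simulation {L : Language α} {ε : ℝ} (hε : 0 ≤ ε)
    (h : M.RecognizesNegative L ε) : M.simulation.Recognizes L ε := by
  refine ⟨fun w hw => ?_, fun w hw => ?_⟩
  · refine le_trans ?_ (M.tsum_le_simulation w (Or.inl ⟨rfl, rfl⟩))
    have := h.1 w hw
    rw [acceptProb, roundAcc] at this
    rw [this]
    linarith
  · exact (h.2 w hw).trans (M.tsum_le_simulation w (Or.inr ⟨rfl, rfl⟩))

end OneQFARestart

theorem InSEqRat.exists_twoQCFA {α : Type*} {L : Language α} (h : InSEqRat L) {ε : ℝ}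
    (hε : 0 < ε) : ∃ (n m : ℕ) (M : TwoQCFA (Fin n) (Fin m) α), M.Recognizes L ε := by
  obtain ⟨n, hn⟩ := h.isSeriesZeroSet.exists_recognizesNegative
  obtain ⟨M, hM⟩ := hn ε hε
  exact ⟨n, _, _, (hM.simulation hε.le).mapStates (Fintype.equivFin (SimState n))⟩

end FiniteAutomata

end

theorem mainTheorem5 :
    (∀ (α : Type*) [Finite α] (L : Language α), FiniteAutomata.InSEqRat L →
      ∃ n : ℕ, ∀ ε : ℝ, 0 < ε →
        (∃ M : FiniteAutomata.OneQFARestart (Fin n) α, M.RecognizesNegative L ε) ∧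
        (∃ M : FiniteAutomata.OneQFARestart (Fin n) α, M.RecognizesPositive Lᶜ ε)) ∧
    FiniteAutomata.InSEqRat FiniteAutomata.langEq ∧
    (∀ (α : Type*) [Finite α], FiniteAutomata.InSEqRat (FiniteAutomata.langPal α)) ∧
    FiniteAutomata.InSEqRat FiniteAutomata.langSquare ∧
    FiniteAutomata.InSEqRat FiniteAutomata.langPower ∧
    (∀ (k r : ℕ) (p : Fin r → MvPolynomial (Fin k) ℤ),
      FiniteAutomata.InSEqRat (FiniteAutomata.polynomialLanguage p)) ∧
    (∀ ε : ℝ, 0 < ε →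
      (∃ (n m : ℕ) (M : FiniteAutomata.TwoQCFA (Fin n) (Fin m) (Fin 2)),
        M.Recognizes FiniteAutomata.langSquare ε) ∧
      (∃ (n m : ℕ) (M : FiniteAutomata.TwoQCFA (Fin n) (Fin m) (Fin 2)),
        M.Recognizes FiniteAutomata.langPower ε)) := by
  refine ⟨fun α _ L hL => ?_, FiniteAutomata.isSeriesZeroSet_langEq.inSEqRat,
    fun α _ => FiniteAutomata.isSeriesZeroSet_langPal.inSEqRat,
    FiniteAutomata.isSeriesZeroSet_langSquare.inSEqRat,
    FiniteAutomata.isSeriesZeroSet_langPower.inSEqRat,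
    fun k r p => (FiniteAutomata.isSeriesZeroSet_polynomialLanguage p).inSEqRat,
    fun ε hε => ⟨FiniteAutomata.isSeriesZeroSet_langSquare.inSEqRat.exists_twoQCFA hε,
      FiniteAutomata.isSeriesZeroSet_langPower.inSEqRat.exists_twoQCFA hε⟩⟩
  obtain ⟨n, hn⟩ := hL.isSeriesZeroSet.exists_recognizesNegative
  refine ⟨n, fun ε hε => ?_⟩
  obtain ⟨M, hM⟩ := hn ε hε
  exact ⟨⟨M, hM⟩, ⟨M.swap, hM.swap⟩⟩
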